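/- Let $D=\sum_{i\in I} n_i[t_i]$ be an effective divisor on $\mathbb P^1=\mathbb P^1_{\mathbb C}$, with $I=\{1,\dots,\nu\}$, distinct points $t_i$ and $n_i\ge 1$. A refined parabolic bundle of rank $2$ over $(\mathbb P^1,D)$ is a rank $2$ vector bundle $E$ together with, for each $i\in I$, a filtration $E|_{n_i[t_i]}\supset l_{i,n_i}\supset\cdots\supset l_{i,1}\supset l_{i,0}=0$ by $\mathcal O_{n_i[t_i]}$-submodules with $\mathrm{length}(l_{i,k})=k$. For a line subbundle $L\subset E$ put $a_{i,k}(L)=\mathrm{length}\big((l_{i,k}\cap L|_{n_i[t_i]})/(l_{i,k-1}\cap L|_{n_i[t_i]})\big)$ and, for weights $\boldsymbol w=(w_{i,k})$ with $0\le w_{i,n_i}\le\cdots\le w_{i,1}\le 1$, $$\mathrm{Stab}_{\boldsymbol w}(L)=\deg E-2\deg L+\sum_{i\in I}\sum_{k=1}^{n_i}w_{i,k}\,(1-2a_{i,k}(L)).$$ Put $\epsilon_{i,k}(L)=-1$ if $a_{i,k}(L)\ne 0$ and $\epsilon_{i,k}(L)=1$ otherwise, $N_i(L)=\max_{1\le k'\le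 n_i}\sum_{k=1}^{k'}\epsilon_{i,k}(L)$ and $I_L^+=\{i\in I: N_i(L)>0\}$. The refined parabolic bundle is called tame if for every line subbundle $L$ with $\deg E\le 2\deg L$ the set $I_L^+$ is non-empty and $-\deg E+2\deg L+1\le\sum_{i\in I_L^+}N_i(L)$. It is called undecomposable if there is no decomposition $E=L_1\oplus L_2$ into line subbundles such that $l_{i,k}=(l_{i,k}\cap L_1|_{n_i[t_i]})\oplus(l_{i,k}\cap L_2|_{n_i[t_i]})$ for all $i\in I$ and $1\le k\le n_i$. Fix $i_0\in I$ and set $E^{(k)}=\ker(E\to E|_{n_{i_0}[t_{i_0}]}/l_{i_0,k})$ for $0\le k\le n_{i_0}$, $E'=E^{(n_{i_0})}$ and $(E')^{(n_{i_0}-k)}=E^{(k)}(-k[t_{i_0}])$. The elementary transformation $\mathrm{elm}^-_{n_{i_0}[t_{i_0}]}(E,\{l_{i,\bullet}\})$ is the refined parabolic bundle consisting of $E'$ with $l'_{i_0,k}=(E')^{(k)}/(E')^{(0)}$ (where $(E')^{(0)}=E'(-n_{i_0}[t_{i_0}])$) and $l'_{i,k}=l_{i,k}$ for $i\ne i_0$.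 Define new weights by $w'_{i_0,k}=1-w_{i_0,n_{i_0}-k+1}$ for $1\le k\le n_{i_0}$ and $w'_{i,k}=w_{i,k}$ for $i\neq i_0$. Then for all weights $\boldsymbol w$ and every line subbundle $L\subset E$, with induced line subbundle $L'=L\cap E'\subset E'$, one has $$\mathrm{Stab}_{\boldsymbol w}(L)=\mathrm{Stab}_{\boldsymbol w'}(L'),$$ where the right-hand side is computed in the elementary transformation. Moreover, if $(E,\{l_{i,\bullet}\})$ is tame, then so is its elementary transformation, and if $(E,\{l_{i,\bullet}\})$ is undecomposable, then so is its elementary transformation. -/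

import Mathlib

open scoped WithZero
open Polynomial

noncomputable section

namespace RefinedParabolic

section Algebra

variable {O : Type*} [CommRing O] {M : Type*} [AddCommGroup M] [Module O M]

/-- The length of `A / (A ∩ B)`; for `B ≤ A` this is the length of `A / B`. -/
def relLength (A B : Submodule O M) : ℕ∞ :=
  Module.length O (A ⧸ B.submoduleOf A)

/-- The image in `A / C` of the submodule `N` of `M` (more precisely, of `N ∩ A`). -/
def toQuot (A C N : Submodule O M) : Submodule O (A ⧸ C.submoduleOf A) :=
  (N.submoduleOf A).map (C.submoduleOf A).mkQ

/-- The preimage in `A`, as a submodule of `M`, of a submodule of `A / C`; that is, the kernel of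
`A → (A / C) / l`. -/
def ofQuot {A C : Submodule O M} (l : Submodule O (A ⧸ C.submoduleOf A)) : Submodule O M :=
  (l.comap (C.submoduleOf A).mkQ).map A.subtype

theorem relLength_add {A B C : Submodule O M} (hCB : C ≤ B) (hBA : B ≤ A) :
    relLength A C = relLength B C + relLength A B := by
  have h1 : C.submoduleOf B ≤ (C.submoduleOf A).comap (Submodule.inclusion hBA) := by
    intro x hx; exact hx
  have h2 : C.submoduleOf A ≤ B.submoduleOf A := fun x hx => hCB hx
  refine Module.length_eq_add_of_exact
    (Submodule.mapQ _ _ (Submodule.inclusion hBA) h1) (Submodule.factor h2) ?_ ?_ ?_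
  · rw [← LinearMap.ker_eq_bot, Submodule.ker_mapQ]
    rw [← le_bot_iff, Submodule.map_le_iff_le_comap, Submodule.comap_bot, Submodule.ker_mkQ]
    intro x hx; exact hx
  · exact Submodule.factor_surjective h2
  · rw [LinearMap.exact_iff, Submodule.range_mapQ]
    ext x
    obtain ⟨x, rfl⟩ := Submodule.mkQ_surjective _ x
    rw [LinearMap.mem_ker, Submodule.mkQ_apply,
      show Submodule.factor h2 (Submodule.Quotient.mk x) = Submodule.Quotient.mk x from rfl,
      Submodule.Quotient.mk_eq_zero]
    constructor
    · intro hx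
      exact ⟨x, ⟨⟨x.1, hx⟩, rfl⟩, rfl⟩
    · rintro ⟨y, ⟨z, rfl⟩, hy⟩
      rw [Submodule.mkQ_apply, Submodule.Quotient.eq] at hy
      have : (x : M) = z - (z - x) := by abel
      show (x : M) ∈ B
      rw [this]
      exact B.sub_mem z.2 (hCB hy)

theorem relLength_self (A : Submodule O M) : relLength A A = 0 := by
  unfold relLength
  rw [Module.length_eq_zero_iff, Submodule.Quotient.subsingleton_iff]
  simp [Submodule.submoduleOf]

theorem relLength_map {N : Type*} [AddCommGroup N] [Module O N] (e : M ≃ₗ[O] N)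
    (A B : Submodule O M) :
    relLength (A.map (e : M →ₗ[O] N)) (B.map (e : M →ₗ[O] N)) = relLength A B := by
  refine (LinearEquiv.length_eq (Submodule.Quotient.equiv _ _ (e.submoduleMap A) ?_)).symm
  ext ⟨x, hx⟩
  obtain ⟨y, hy, rfl⟩ := hx
  simp only [Submodule.mem_map, Submodule.submoduleOf, Submodule.mem_comap]
  constructor
  · rintro ⟨z, hz, h⟩
    exact ⟨z, hz, congrArg Subtype.val h⟩
  · rintro ⟨z, hz, h⟩
    have : z = y := e.injective h
    subst this
    exact ⟨⟨z, hy⟩, hz, rfl⟩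

theorem length_toQuot {A C N : Submodule O M} (hNA : N ≤ A) :
    Module.length O (toQuot A C N) = relLength N C := by
  let φ : N →ₗ[O] A ⧸ C.submoduleOf A := (C.submoduleOf A).mkQ ∘ₗ Submodule.inclusion hNA
  have hr : LinearMap.range φ = toQuot A C N := by
    rw [LinearMap.range_comp, Submodule.range_inclusion]; rfl
  have hk : LinearMap.ker φ = C.submoduleOf N := by
    ext x
    rw [LinearMap.mem_ker]
    exact Submodule.Quotient.mk_eq_zero _
  unfold relLength
  rw [← hr, ← hk]
  exact φ.quotKerEquivRange.symm.length_eq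

theorem ofQuot_le {A C : Submodule O M} (l : Submodule O (A ⧸ C.submoduleOf A)) :
    ofQuot l ≤ A := by
  rintro _ ⟨x, _, rfl⟩; exact x.2

theorem le_ofQuot {A C : Submodule O M} (hCA : C ≤ A) (l : Submodule O (A ⧸ C.submoduleOf A)) :
    C ≤ ofQuot l := by
  intro x hx
  refine ⟨⟨x, hCA hx⟩, ?_, rfl⟩
  have : (C.submoduleOf A).mkQ ⟨x, hCA hx⟩ = 0 := by
    rw [Submodule.mkQ_apply, Submodule.Quotient.mk_eq_zero]; exact hx
  simp only [SetLike.mem_coe, Submodule.mem_comap]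
  rw [this]; exact l.zero_mem

theorem toQuot_ofQuot {A C : Submodule O M} (l : Submodule O (A ⧸ C.submoduleOf A)) :
    toQuot A C (ofQuot l) = l := by
  unfold toQuot ofQuot Submodule.submoduleOf
  rw [Submodule.comap_map_eq_of_injective (Submodule.subtype_injective A)]
  exact Submodule.map_comap_eq_of_surjective (Submodule.mkQ_surjective _) l

theorem ofQuot_mono {A C : Submodule O M} {l l' : Submodule O (A ⧸ C.submoduleOf A)}
    (h : l ≤ l') : ofQuot l ≤ ofQuot l' :=
  Submodule.map_mono (Submodule.comap_mono h)

theorem toQuot_mono {A C N N' : Submodule O M} (h : N ≤ N') : toQuot A C N ≤ toQuot A C N' :=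
  Submodule.map_mono (Submodule.comap_mono h)

theorem relLength_ofQuot {A C : Submodule O M} (l : Submodule O (A ⧸ C.submoduleOf A)) :
    relLength (ofQuot l) C = Module.length O l := by
  conv_rhs => rw [← toQuot_ofQuot l]
  exact (length_toQuot (ofQuot_le l)).symm

/-- If `A / B` has length one over a local ring, then the maximal ideal maps `A` into `B`. -/
theorem maximalIdeal_smul_le [IsLocalRing O] {A B : Submodule O M} (h : relLength A B = 1) :
    IsLocalRing.maximalIdeal O • A ≤ B := by
  have hs : IsSimpleModule O (A ⧸ B.submoduleOf A) := Module.length_eq_one_iff.mp h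
  have hm : (Module.annihilator O (A ⧸ B.submoduleOf A)).IsMaximal :=
    IsSimpleModule.annihilator_isMaximal
  have hm' := IsLocalRing.eq_maximalIdeal hm
  rw [Submodule.smul_le]
  intro r hr a ha
  rw [← hm', Module.mem_annihilator] at hr
  have := hr (Submodule.Quotient.mk ⟨a, ha⟩)
  rw [← Submodule.Quotient.mk_smul, Submodule.Quotient.mk_eq_zero] at this
  exact this

end Algebra

section Lattice

variable {O K V : Type*} [CommRing O] [IsDomain O] [IsDiscreteValuationRing O] [Field K]
  [Algebra O K] [IsFractionRing O K] [AddCommGroup V] [Module K V] [Module O V]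
  [IsScalarTower O K V]

local notation "𝔪" => IsLocalRing.maximalIdeal O

theorem exists_basis_of_lattice {r : ℕ} (hr : Module.finrank K V = r) (A : Submodule O V)
    (hfg : A.FG) (hspan : Submodule.span K (A : Set V) = ⊤) :
    ∃ b : Module.Basis (Fin r) K V, A = Submodule.span O (Set.range b) := by
  have : Submodule.IsLattice K A := ⟨hfg, hspan⟩
  have : Module.Finite O A := Submodule.IsLattice.finite K A
  have : Module.Free O A := Submodule.IsLattice.free K A
  let b₀ := Module.finBasis O A
  have hn : Module.finrank O A = r := by
    rw [← hr]
    exact congrArg Cardinal.toNat (Submodule.IsLattice.rank' K A)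
  let b := (b₀.extendOfIsLattice K).reindex (finCongr hn)
  refine ⟨b, ?_⟩
  have : Set.range b = A.subtype '' Set.range b₀ := by
    rw [← Set.range_comp]
    ext v
    constructor
    · rintro ⟨i, rfl⟩; exact ⟨(finCongr hn).symm i, by simp [b]⟩
    · rintro ⟨i, rfl⟩; exact ⟨finCongr hn i, by simp [b]⟩
  rw [this, ← Submodule.map_span, b₀.span_eq, Submodule.map_top, Submodule.range_subtype]

theorem relLength_smul_self {r : ℕ} (b : Module.Basis (Fin r) K V) :
    relLength (Submodule.span O (Set.range b)) (𝔪 • Submodule.span O (Set.range b)) = r := by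
  set A := Submodule.span O (Set.range b) with hA
  have hli : LinearIndependent O b := 
    (LinearIndependent.iff_fractionRing (R := O) (K := K)).mpr b.linearIndependent
  let b₀ : Module.Basis (Fin r) O A := Module.Basis.span hli
  have : Module.Free O A := Module.Free.of_basis b₀
  have : Module.Finite O A := Module.Finite.of_basis b₀
  have h1 : (𝔪 • A).submoduleOf A = 𝔪 • (⊤ : Submodule O A) := by
    apply Submodule.map_injective_of_injective (Submodule.subtype_injective A)
    rw [Submodule.map_smul'', Submodule.map_top, Submodule.range_subtype]
    rw [Submodule.submoduleOf, Submodule.map_comap_subtype]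
    exact inf_eq_right.mpr Submodule.smul_le_right
  unfold relLength
  rw [h1, ← (TensorProduct.quotTensorEquivQuotSMul A 𝔪).length_eq]
  have h2 := Module.length_eq_of_surjective (R := O ⧸ 𝔪) (S := O) 
    (M := TensorProduct O (O ⧸ 𝔪) A) Ideal.Quotient.mk_surjective
  rw [h2]
  let _ : Field (O ⧸ 𝔪) := Ideal.Quotient.field 𝔪
  rw [Module.length_eq_finrank, Module.finrank_baseChange, Module.finrank_eq_card_basis b₀]
  simp

theorem exists_pow_smul_eq_map (O K V : Type*) [CommRing O] [IsDomain O]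
    [IsDiscreteValuationRing O] [Field K] [Algebra O K] [IsFractionRing O K] [AddCommGroup V]
    [Module K V] [Module O V] [IsScalarTower O K V] (j : ℕ) :
    ∃ e : V ≃ₗ[O] V, ∀ A : Submodule O V,
      IsLocalRing.maximalIdeal O ^ j • A = A.map (e : V →ₗ[O] V) := by
  obtain ⟨ϖ, hϖ⟩ := IsDiscreteValuationRing.exists_irreducible O
  have h0 : algebraMap O K (ϖ ^ j) ≠ 0 := by
    rw [Ne, IsFractionRing.to_map_eq_zero_iff]
    exact pow_ne_zero _ hϖ.ne_zero
  refine ⟨(LinearEquiv.smulOfNeZero K V _ h0).restrictScalars O, fun A => ?_⟩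
  rw [hϖ.maximalIdeal_eq, Ideal.span_singleton_pow, Submodule.ideal_span_singleton_smul]
  ext v
  simp only [Submodule.mem_smul_pointwise_iff_exists, Submodule.mem_map]
  constructor
  · rintro ⟨a, ha, rfl⟩
    exact ⟨a, ha, algebraMap_smul K (ϖ ^ j) a⟩
  · rintro ⟨a, ha, rfl⟩
    exact ⟨a, ha, (algebraMap_smul K (ϖ ^ j) a).symm⟩

/-- The filtration step of an elementary transformation: reversing a chain of lattices. -/
theorem elm_chain {n : ℕ} (F : ℕ → Submodule O V)
    (hF : ∀ k, k ≤ n → ∃ b : Module.Basis (Fin 2) K V, F k = Submodule.span O (Set.range b))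
    (hle : ∀ k, k < n → F k ≤ F (k + 1)) (hlen : ∀ k, k ≤ n → relLength (F k) (F 0) = k) :
    (∀ j, j < n → 𝔪 ^ (j + 1) • F (j + 1) ≤ 𝔪 ^ j • F j) ∧
      ∀ i j, i + j = n → relLength (𝔪 ^ j • F j) (𝔪 ^ n • F n) = i := by
  have hle0 : ∀ k, k ≤ n → F 0 ≤ F k := by
    intro k
    induction k with
    | zero => intro _; exact le_rfl
    | succ k ih => intro h; exact (ih (by omega)).trans (hle k (by omega))
  have hone : ∀ k, k < n → relLength (F (k + 1)) (F k) = 1 := by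
    intro k hk
    have h1 := relLength_add (hle0 k hk.le) (hle k hk)
    rw [hlen k hk.le, hlen (k + 1) hk, Nat.cast_add] at h1
    exact (ENat.add_right_injective_of_ne_top (ENat.natCast_ne_top k) h1).symm
  have hm : ∀ k, k < n → 𝔪 • F (k + 1) ≤ F k := fun k hk => maximalIdeal_smul_le (hone k hk)
  have hstep : ∀ j, j < n → 𝔪 ^ (j + 1) • F (j + 1) ≤ 𝔪 ^ j • F j := by
    intro j hj
    rw [pow_succ, Submodule.mul_smul]
    exact smul_mono_right _ (hm j hj)
  have hstepLen : ∀ j, j < n →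
      relLength (𝔪 ^ j • F j) (𝔪 ^ (j + 1) • F (j + 1)) = 1 := by
    intro j hj
    obtain ⟨e, he⟩ := exists_pow_smul_eq_map O K V j
    rw [pow_succ, Submodule.mul_smul, he, he, relLength_map]
    obtain ⟨b, hb⟩ := hF (j + 1) hj
    have h2 : relLength (F (j + 1)) (𝔪 • F (j + 1)) = (2 : ℕ) := by
      rw [hb]; exact relLength_smul_self b
    rw [relLength_add (hm j hj) (hle j hj), hone j hj] at h2
    have : relLength (F j) (𝔪 • F (j + 1)) + 1 = 1 + 1 := by rw [h2]; rfl
    exact ENat.add_left_injective_of_ne_top ENat.one_ne_top this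
  refine ⟨hstep, ?_⟩
  have hchain : ∀ i j, i + j = n → 𝔪 ^ n • F n ≤ 𝔪 ^ j • F j := by
    intro i
    induction i with
    | zero => intro j hj; rw [show j = n by omega]
    | succ i ih => intro j hj; exact (ih (j + 1) (by omega)).trans (hstep j (by omega))
  intro i
  induction i with
  | zero => intro j hj; rw [show j = n by omega, relLength_self]; rfl
  | succ i ih =>
    intro j hj
    rw [relLength_add (hchain i (j + 1) (by omega)) (hstep j (by omega)), ih (j + 1) (by omega),
      hstepLen j (by omega), Nat.cast_add]
    rfl

end Lattice

section ProjectiveLine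

/-- The function field `ℂ(x)` of the projective line `ℙ¹` over `ℂ`. -/
abbrev FunField := RatFunc ℂ
/-- The closed points of `ℙ¹`. -/
abbrev Point := OnePoint ℂ

/-- The maximal ideal `(x - a)` of `ℂ[x]`. -/
def finitePlace (a : ℂ) : IsDedekindDomain.HeightOneSpectrum ℂ[X] where
  asIdeal := Ideal.span {X - C a}
  isPrime := (Ideal.span_singleton_prime (X_sub_C_ne_zero a)).mpr (prime_X_sub_C a)
  ne_bot := by simpa using X_sub_C_ne_zero a

open Classical in
/-- The order of vanishing at a closed point of `ℙ¹`, as a (multiplicative) valuation of `ℂ(x)`. -/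
def place : Point → Valuation FunField ℤᵐ⁰
  | .infty => RatFunc.inftyValuation ℂ
  | .some a => (finitePlace a).valuation FunField

/-- The local ring of `ℙ¹` at `p`, as a subring of the function field. -/
abbrev localRing (p : Point) : ValuationSubring FunField := (place p).valuationSubring

open Classical in
instance (p : Point) : IsDiscreteValuationRing (localRing p) := by
  have : (place p).IsNontrivial := by
    cases p with
    | none => exact inferInstanceAs ((RatFunc.inftyValuation ℂ).IsNontrivial)
    | some a => exact inferInstanceAs (((finitePlace a).valuation FunField).IsNontrivial)
  exact (place p).valuationSubring_isDiscreteValuationRing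

instance (p : Point) : SMul (localRing p) FunField :=
  Algebra.toSMul (self := (inferInstance : Algebra (localRing p) FunField))
instance {V : Type*} [AddCommGroup V] [Module FunField V] (p : Point) :
    IsScalarTower (localRing p) FunField V :=
  ⟨fun a b v => mul_smul (a : FunField) b v⟩

/-- A rational function has finitely many poles. -/
theorem finite_not_mem (f : FunField) : {p | f ∉ localRing p}.Finite := by
  have h : {p | f ∉ localRing p} ⊆ insert .infty (OnePoint.some '' (f.denom.rootSet ℂ)) := by
    intro p hp
    cases p with
    | none => exact Set.mem_insert _ _
    | some a =>
      refine Set.mem_insert_of_mem _ ⟨a, ?_, rfl⟩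
      by_contra hr
      apply hp
      show (finitePlace a).valuation FunField f ≤ 1
      have h1 : (finitePlace a).valuation FunField (algebraMap ℂ[X] FunField f.denom) = 1 := by
        rw [IsDedekindDomain.HeightOneSpectrum.valuation_of_algebraMap,
          IsDedekindDomain.HeightOneSpectrum.intValuation_eq_one_iff]
        intro hmem
        apply hr
        rw [Polynomial.mem_rootSet]
        refine ⟨f.denom_ne_zero, ?_⟩
        have := Ideal.mem_span_singleton.mp hmem
        rw [dvd_iff_isRoot] at this
        simpa using this
      rw [← RatFunc.num_div_denom f, map_div₀, h1, div_one]
      exact IsDedekindDomain.HeightOneSpectrum.valuation_le_one _ _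
  exact (((Polynomial.rootSet_finite _ _).image _).insert _).subset h

/-- A vector bundle of rank `r` on `ℙ¹` with generic fibre `V`, viewed as a sheaf of submodules of
the constant sheaf `V`: it is given by its stalks `E_p ⊆ V` at the closed points (its sections over
an open set `U` are the `v ∈ V` that lie in `E_p` for all `p ∈ U`), and it is locally free: every
point has a Zariski open neighbourhood `U` (an open set is the complement of finitely many points)
over which a suitable basis of `V` is a frame. -/
structure VectorBundle (V : Type*) [AddCommGroup V] [Module FunField V] (r : ℕ) where
  stalk : ∀ p : Point, Submodule (localRing p) V
  locally_free : ∀ p, ∃ (b : Module.Basis (Fin r) FunField V) (U : Set Point), Uᶜ.Finite ∧ p ∈ U ∧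
    ∀ q ∈ U, stalk q = Submodule.span (localRing q) (Set.range b)

variable {V : Type*} [AddCommGroup V] [Module FunField V] {r : ℕ}

/-- The difference of lengths `length (A / (A ∩ B)) - length (B / (A ∩ B))`. -/
def index {p : Point} (A B : Submodule (localRing p) V) : ℤ :=
  ((relLength A B).toNat : ℤ) - ((relLength B A).toNat : ℤ)

/-- The degree of a vector bundle: the sum over all points of the local indices of `E` relative to
the trivial bundle spanned by a basis of the generic fibre. (By the product formula the sum does
not depend on the basis.) For a line bundle this is the degree of the divisor of a rational
section. -/
def VectorBundle.degree (E : VectorBundle V r) : ℤ :=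
  ∑ᶠ p : Point, index (E.stalk p)
    (Submodule.span (localRing p) (Set.range (Module.Basis.ofVectorSpace FunField V)))

theorem mem_span_basis {ι : Type*} (b : Module.Basis ι FunField V) (q : Point) (v : V) :
    v ∈ Submodule.span (localRing q) (Set.range b) ↔ ∀ i, b.repr v i ∈ localRing q := by
  rw [b.mem_span_iff_repr_mem (localRing q)]
  refine forall_congr' fun i => ?_
  constructor
  · rintro ⟨a, ha⟩; rw [← ha]; exact a.2
  · intro h; exact ⟨⟨_, h⟩, rfl⟩

theorem finite_span_ne (b c : Module.Basis (Fin r) FunField V) :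
    {q : Point | Submodule.span (localRing q) (Set.range b) ≠
      Submodule.span (localRing q) (Set.range c)}.Finite := by
  have hb : (⋃ i, ⋃ j, {q : Point | b.repr (c i) j ∉ localRing q}).Finite :=
    Set.finite_iUnion fun i => Set.finite_iUnion fun j => finite_not_mem _
  have hc : (⋃ i, ⋃ j, {q : Point | c.repr (b i) j ∉ localRing q}).Finite :=
    Set.finite_iUnion fun i => Set.finite_iUnion fun j => finite_not_mem _
  refine (hb.union hc).subset fun q hq => ?_
  by_contra h
  simp only [Set.mem_union, Set.mem_iUnion, Set.mem_ofPred_eq, not_or, not_exists, not_not] at h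
  apply hq
  apply le_antisymm
  · rw [Submodule.span_le]
    rintro _ ⟨i, rfl⟩
    exact (mem_span_basis c q _).mpr (h.2 i)
  · rw [Submodule.span_le]
    rintro _ ⟨i, rfl⟩
    exact (mem_span_basis b q _).mpr (h.1 i)

theorem VectorBundle.finrank_eq (E : VectorBundle V r) : Module.finrank FunField V = r := by
  obtain ⟨b, -⟩ := E.locally_free .infty
  simpa using Module.finrank_eq_card_basis b

theorem VectorBundle.exists_basis (E : VectorBundle V r) (p : Point) :
    ∃ b : Module.Basis (Fin r) FunField V,
      E.stalk p = Submodule.span (localRing p) (Set.range b) := by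
  obtain ⟨b, U, -, hp, h⟩ := E.locally_free p
  exact ⟨b, h p hp⟩

theorem VectorBundle.fg (E : VectorBundle V r) (p : Point) : (E.stalk p).FG := by
  obtain ⟨b, h⟩ := E.exists_basis p
  rw [h]
  exact Submodule.fg_span (Set.finite_range b)

theorem VectorBundle.fg_of_le (E : VectorBundle V r) {p : Point} {A : Submodule (localRing p) V}
    (h : A ≤ E.stalk p) : A.FG := by
  have : Module.Finite (localRing p) (E.stalk p) := Module.Finite.iff_fg.mpr (E.fg p)
  have : IsNoetherian (localRing p) A := isNoetherian_of_le h
  exact Module.Finite.iff_fg.mp inferInstance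

/-- Denominators: an element of the `ℂ(x)`-span of `A` has a nonzero multiple in `A`. -/
theorem exists_smul_mem {p : Point} (A : Submodule (localRing p) V) {v : V}
    (hv : v ∈ Submodule.span FunField (A : Set V)) :
    ∃ a : localRing p, a ≠ 0 ∧ a • v ∈ A := by
  induction hv using Submodule.span_induction with
  | mem x hx => exact ⟨1, one_ne_zero, by simpa using hx⟩
  | zero => exact ⟨1, one_ne_zero, by simp⟩
  | add x y _ _ hx hy =>
    obtain ⟨a, ha, hax⟩ := hx
    obtain ⟨c, hc, hcy⟩ := hy
    refine ⟨a * c, mul_ne_zero ha hc, ?_⟩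
    rw [smul_add]
    refine A.add_mem ?_ ?_
    · rw [mul_comm, mul_smul]; exact A.smul_mem c hax
    · rw [mul_smul]; exact A.smul_mem a hcy
  | smul f x _ hx =>
    obtain ⟨a, ha, hax⟩ := hx
    obtain ⟨y, s, hs, hf⟩ := IsFractionRing.div_surjective (A := localRing p) f
    have hs0 : s ≠ 0 := nonZeroDivisors.ne_zero hs
    refine ⟨a * s, mul_ne_zero ha hs0, ?_⟩
    have h : (a * s) • f • x = y • a • x := by
      rw [← algebraMap_smul FunField (a * s), ← algebraMap_smul FunField y,
        ← algebraMap_smul FunField a, smul_smul, smul_smul, ← hf, map_mul]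
      congr 1
      have : algebraMap (localRing p) FunField s ≠ 0 := by
        rwa [Ne, IsFractionRing.to_map_eq_zero_iff]
      field_simp
    rw [h]
    exact A.smul_mem y hax

theorem VectorBundle.span_stalk (E : VectorBundle V r) (p : Point) :
    Submodule.span FunField (E.stalk p : Set V) = ⊤ := by
  obtain ⟨b, h⟩ := E.exists_basis p
  rw [h, Submodule.span_span_of_tower, b.span_eq]

open Classical in
/-- The vector bundle that agrees with `E` away from `p` and has stalk `A` at `p`. -/
def VectorBundle.modify (E : VectorBundle V r) (p : Point) (A : Submodule (localRing p) V)
    (hA : ∃ b : Module.Basis (Fin r) FunField V,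
      A = Submodule.span (localRing p) (Set.range b)) : VectorBundle V r where
  stalk := Function.update E.stalk p A
  locally_free q := by
    by_cases hq : q = p
    · subst hq
      obtain ⟨b, hb⟩ := hA
      obtain ⟨c, U, hU, -, hc⟩ := E.locally_free q
      refine ⟨b, insert q (U ∩ {s : Point | Submodule.span (localRing s) (Set.range b) =
        Submodule.span (localRing s) (Set.range c)}), ?_, Set.mem_insert _ _, ?_⟩
      · refine (hU.union (finite_span_ne b c)).subset fun s hs => ?_
        simp only [Set.mem_compl_iff, Set.mem_insert_iff, Set.mem_inter_iff, Set.mem_ofPred_eq,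
          not_or, not_and_or] at hs
        exact hs.2
      · intro s hs
        by_cases hsq : s = q
        · subst hsq
          rw [Function.update_self]; exact hb
        · rw [Function.update_of_ne hsq]
          rcases hs with hs | hs
          · exact absurd hs hsq
          · rw [hs.2]; exact hc s hs.1
    · obtain ⟨c, U, hU, hqU, hc⟩ := E.locally_free q
      refine ⟨c, U \ {p}, ?_, ⟨hqU, hq⟩, ?_⟩
      · refine (hU.union (Set.finite_singleton p)).subset fun s hs => ?_
        by_contra h
        simp only [Set.mem_union, Set.mem_compl_iff, Set.mem_singleton_iff, not_or, not_not] at h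
        exact hs ⟨h.1, h.2⟩
      · intro s hs
        rw [Function.update_of_ne hs.2]
        exact hc s hs.1

/-- The stalk at `p` of the twist `E(-n[p])`. -/
def VectorBundle.twist (E : VectorBundle V r) (p : Point) (n : ℕ) : Submodule (localRing p) V :=
  IsLocalRing.maximalIdeal (localRing p) ^ n • E.stalk p

theorem VectorBundle.twist_le (E : VectorBundle V r) (p : Point) (n : ℕ) :
    E.twist p n ≤ E.stalk p := Submodule.smul_le_right

/-- The restriction `E|_{n[p]} = E / E(-n[p])` of `E` to the subscheme `n[p]`. Its submodules over
the local ring at `p` are the same as those over `𝒪_{n[p]}`, with the same lengths. -/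
abbrev VectorBundle.fiber (E : VectorBundle V r) (p : Point) (n : ℕ) : Type _ :=
  E.stalk p ⧸ (E.twist p n).submoduleOf (E.stalk p)

/-- A line subbundle of `E`: a subsheaf of rank one whose quotient is torsion free, that is,
locally free. -/
structure LineSubbundle (E : VectorBundle V r) where
  generic : Submodule FunField V
  finrank_generic : Module.finrank FunField generic = 1
  stalk : ∀ p : Point, Submodule (localRing p) V
  stalk_le : ∀ p, stalk p ≤ E.stalk p
  span_stalk : ∀ p, Submodule.span FunField (stalk p : Set V) = generic
  saturated : ∀ (p : Point) (a : localRing p) (v : V),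
    a ≠ 0 → v ∈ E.stalk p → a • v ∈ stalk p → v ∈ stalk p

namespace LineSubbundle

variable {E : VectorBundle V r}

theorem mem_stalk (L : LineSubbundle E) (p : Point) (v : V) :
    v ∈ L.stalk p ↔ v ∈ E.stalk p ∧ v ∈ L.generic := by
  constructor
  · intro h
    refine ⟨L.stalk_le p h, ?_⟩
    rw [← L.span_stalk p]
    exact Submodule.subset_span h
  · rintro ⟨h1, h2⟩
    rw [← L.span_stalk p] at h2
    obtain ⟨a, ha, hav⟩ := exists_smul_mem _ h2
    exact L.saturated p a v ha h1 hav

/-- A line subbundle, as a vector bundle of rank one. -/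
def toVectorBundle (L : LineSubbundle E) : VectorBundle L.generic 1 where
  stalk p := (L.stalk p).comap (L.generic.subtype.restrictScalars (localRing p))
  locally_free p := by
    set ι := L.generic.subtype.restrictScalars (localRing p) with hι
    have hinj : Function.Injective ι := Subtype.val_injective
    have hmap : ((L.stalk p).comap ι).map ι = L.stalk p := by
      apply Submodule.map_comap_eq_self
      intro v hv
      exact ⟨⟨v, ((L.mem_stalk p v).mp hv).2⟩, rfl⟩
    have hfg : ((L.stalk p).comap ι).FG := by
      apply Submodule.fg_of_fg_map_injective ι hinj
      rw [hmap]
      exact E.fg_of_le (L.stalk_le p)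
    have hspan : Submodule.span FunField ((L.stalk p).comap ι : Set L.generic) = ⊤ := by
      rw [eq_top_iff]
      rintro ⟨w, hw⟩ -
      have hw' := hw
      rw [← L.span_stalk p] at hw'
      obtain ⟨a, ha, haw⟩ := exists_smul_mem _ hw'
      have h0 : (a : FunField) ≠ 0 := fun h => ha (Subtype.ext h)
      have hmem : (a : FunField) • (⟨w, hw⟩ : L.generic) ∈
          Submodule.span FunField ((L.stalk p).comap ι : Set L.generic) :=
        Submodule.subset_span haw
      exact (Submodule.smul_mem_iff _ h0).mp hmem
    obtain ⟨b, hb⟩ := exists_basis_of_lattice L.finrank_generic _ hfg hspan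
    obtain ⟨c, U, hU, -, hc⟩ := E.locally_free p
    set w : V := (b 0 : V) with hw
    have hw0 : w ≠ 0 := fun h => b.ne_zero 0 (Subtype.ext h)
    obtain ⟨j, hj⟩ : ∃ j, c.repr w j ≠ 0 := by
      by_contra! h
      exact hw0 (c.repr.map_eq_zero_iff.mp (Finsupp.ext h))
    have hfin : ((⋃ i, {q : Point | c.repr w i ∉ localRing q}) ∪
        {q : Point | (c.repr w j)⁻¹ ∉ localRing q}).Finite :=
      (Set.finite_iUnion fun i => finite_not_mem _).union (finite_not_mem _)
    refine ⟨b, insert p (U \ ((⋃ i, {q : Point | c.repr w i ∉ localRing q}) ∪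
        {q : Point | (c.repr w j)⁻¹ ∉ localRing q})), ?_, Set.mem_insert _ _, ?_⟩
    · refine (hU.union hfin).subset fun s hs => ?_
      by_contra h
      rw [Set.mem_union, not_or, Set.mem_compl_iff, not_not] at h
      exact hs (Set.mem_insert_of_mem _ h)
    · intro q hq
      rcases hq with rfl | ⟨hqU, hq⟩
      · exact hb
      · simp only [Set.mem_union, Set.mem_iUnion, Set.mem_ofPred_eq, not_or, not_exists,
          not_not] at hq
        ext v
        rw [mem_span_basis, Submodule.mem_comap]
        have hv : (v : V) = (b.repr v 0) • w := by
          have := b.sum_repr v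
          rw [Fin.sum_univ_one] at this
          conv_lhs => rw [← this]
          rfl
        have hmem : (v : V) ∈ L.stalk q ↔ ∀ i, b.repr v 0 * c.repr w i ∈ localRing q := by
          rw [L.mem_stalk, hc q hqU, mem_span_basis, hv, map_smul]
          simp only [Finsupp.smul_apply, smul_eq_mul]
          rw [← hv]
          exact and_iff_left v.2
        refine hmem.trans ⟨fun h i => ?_, fun h i => mul_mem (h 0) (hq.1 i)⟩
        rw [Subsingleton.elim i 0]
        have := mul_mem (h j) hq.2
        rwa [mul_assoc, mul_inv_cancel₀ hj, mul_one] at this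

/-- The degree of a line subbundle. -/
def degree (L : LineSubbundle E) : ℤ := L.toVectorBundle.degree

/-- The line subbundle `L ∩ E'` of a bundle `E' ⊆ E` with the same generic fibre. -/
def restrict (L : LineSubbundle E) (E' : VectorBundle V r)
    (h : ∀ p, E'.stalk p ≤ E.stalk p) : LineSubbundle E' where
  generic := L.generic
  finrank_generic := L.finrank_generic
  stalk p := L.stalk p ⊓ E'.stalk p
  stalk_le p := inf_le_right
  span_stalk p := by
    apply le_antisymm
    · rw [← L.span_stalk p]
      exact Submodule.span_mono inf_le_left
    · intro v hv
      have hv' := hv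
      rw [← L.span_stalk p] at hv'
      obtain ⟨a, ha, hav⟩ := exists_smul_mem _ hv'
      obtain ⟨c, hc, hcv⟩ := exists_smul_mem (E'.stalk p) (v := v)
        (by rw [E'.span_stalk]; exact Submodule.mem_top)
      have h0 : (c * a : FunField) ≠ 0 :=
        mul_ne_zero (fun h => hc (Subtype.ext h)) (fun h => ha (Subtype.ext h))
      have hmem : (c * a : FunField) • v ∈
          Submodule.span FunField ((L.stalk p ⊓ E'.stalk p : Submodule _ V) : Set V) := by
        apply Submodule.subset_span
        refine ⟨?_, ?_⟩
        · rw [mul_smul]; exact (L.stalk p).smul_mem c hav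
        · rw [mul_comm, mul_smul]; exact (E'.stalk p).smul_mem a hcv
      exact (Submodule.smul_mem_iff _ h0).mp hmem
  saturated p a v ha hv hav := ⟨L.saturated p a v ha (h p hv) hav.1, hv⟩

/-- The restriction `L|_{n[p]}`, as a submodule of `E|_{n[p]}`. -/
def fiber (L : LineSubbundle E) (p : Point) (n : ℕ) :
    Submodule (localRing p) (E.fiber p n) :=
  toQuot (E.stalk p) (E.twist p n) (L.stalk p)

end LineSubbundle

/-- An effective divisor `∑ i, n i • [t i]` on `ℙ¹` with distinct points `t i` and
multiplicities `n i ≥ 1`. -/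
structure PolarDivisor where
  ν : ℕ
  t : Fin ν → Point
  n : Fin ν → ℕ
  t_injective : Function.Injective t
  n_pos : ∀ i, 1 ≤ n i

/-- A refined parabolic bundle of rank two over `(ℙ¹, D)`: for every `i` a filtration
`E|_{n_i[t_i]} ⊇ l_{i,n_i} ⊇ ⋯ ⊇ l_{i,1} ⊇ l_{i,0} = 0` by submodules, with `l_{i,k}` of length `k`.
(Only the `l i k` with `k ≤ n i` are meaningful.) -/
structure RefinedParabolicBundle (V : Type*) [AddCommGroup V] [Module FunField V]
    (D : PolarDivisor) extends VectorBundle V 2 where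
  l : ∀ i, ℕ → Submodule (localRing (D.t i)) (toVectorBundle.fiber (D.t i) (D.n i))
  l_le : ∀ i k, k < D.n i → l i k ≤ l i (k + 1)
  l_length : ∀ i k, k ≤ D.n i → Module.length (localRing (D.t i)) (l i k) = k

/-- Weights `0 ≤ w_{i,n_i} ≤ ⋯ ≤ w_{i,1} ≤ 1`. (Only the `w i k` with `1 ≤ k ≤ n i` are
meaningful.) -/
structure Weights (D : PolarDivisor) where
  w : Fin D.ν → ℕ → ℝ
  nonneg : ∀ i k, 1 ≤ k → k ≤ D.n i → 0 ≤ w i k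
  le_one : ∀ i k, 1 ≤ k → k ≤ D.n i → w i k ≤ 1
  anti : ∀ i k k', 1 ≤ k → k ≤ k' → k' ≤ D.n i → w i k' ≤ w i k

/-- The weights `w'_{i₀,k} = 1 - w_{i₀,n_{i₀}-k+1}`, and `w'_{i,k} = w_{i,k}` for `i ≠ i₀`. -/
def Weights.elm {D : PolarDivisor} (W : Weights D) (i₀ : Fin D.ν) : Weights D where
  w i k := if i = i₀ then 1 - W.w i (D.n i - k + 1) else W.w i k
  nonneg i k h1 h2 := by
    have := W.le_one i (D.n i - k + 1) (by omega) (by omega)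
    split_ifs
    · linarith
    · exact W.nonneg i k h1 h2
  le_one i k h1 h2 := by
    have := W.nonneg i (D.n i - k + 1) (by omega) (by omega)
    split_ifs
    · linarith
    · exact W.le_one i k h1 h2
  anti i k k' h1 h2 h3 := by
    have := W.anti i (D.n i - k' + 1) (D.n i - k + 1) (by omega) (by omega) (by omega)
    split_ifs
    · linarith
    · exact W.anti i k k' h1 h2 h3

namespace RefinedParabolicBundle

variable {D : PolarDivisor} (E : RefinedParabolicBundle V D)

/-- The length of `(l_{i,k} ∩ L|_{n_i[t_i]}) / (l_{i,k-1} ∩ L|_{n_i[t_i]})`. -/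
def jump (L : LineSubbundle E.toVectorBundle) (i : Fin D.ν) (k : ℕ) : ℕ∞ :=
  relLength (E.l i k ⊓ L.fiber (D.t i) (D.n i)) (E.l i (k - 1) ⊓ L.fiber (D.t i) (D.n i))

/-- The stability index of a line subbundle. -/
def stab (W : Weights D) (L : LineSubbundle E.toVectorBundle) : ℝ :=
  (E.degree : ℝ) - 2 * (L.degree : ℝ) +
    ∑ i, ∑ k ∈ Finset.Icc 1 (D.n i), W.w i k * (1 - 2 * ((E.jump L i k).toNat : ℝ))

open Classical in
/-- The sign `ε_{i,k}(L)`. -/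
def eps (L : LineSubbundle E.toVectorBundle) (i : Fin D.ν) (k : ℕ) : ℤ :=
  if E.jump L i k ≠ 0 then -1 else 1

/-- The integer `N_i(L)`, the maximum over `1 ≤ k' ≤ n_i` of `∑_{k ≤ k'} ε_{i,k}(L)`. -/
def N (L : LineSubbundle E.toVectorBundle) (i : Fin D.ν) : ℤ :=
  (Finset.Icc 1 (D.n i)).sup' (Finset.nonempty_Icc.mpr (D.n_pos i))
    fun k' => ∑ k ∈ Finset.Icc 1 k', E.eps L i k

/-- The set `I⁺_L` of the `i` with `N_i(L) > 0`. -/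
def plusSet (L : LineSubbundle E.toVectorBundle) : Finset (Fin D.ν) :=
  Finset.univ.filter fun i => 0 < E.N L i

/-- Tameness. -/
def Tame : Prop :=
  ∀ L : LineSubbundle E.toVectorBundle, E.degree ≤ 2 * L.degree →
    (E.plusSet L).Nonempty ∧ -E.degree + 2 * L.degree + 1 ≤ ∑ i ∈ E.plusSet L, E.N L i

/-- Decomposability: `E = L₁ ⊕ L₂` with line subbundles such that
`l_{i,k} = (l_{i,k} ∩ L₁|_{n_i[t_i]}) ⊕ (l_{i,k} ∩ L₂|_{n_i[t_i]})` for all `i` and `1 ≤ k ≤ n_i`. -/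
def Decomposable : Prop :=
  ∃ L₁ L₂ : LineSubbundle E.toVectorBundle,
    (∀ p, Disjoint (L₁.stalk p) (L₂.stalk p) ∧ L₁.stalk p ⊔ L₂.stalk p = E.stalk p) ∧
    ∀ i k, 1 ≤ k → k ≤ D.n i →
      Disjoint (E.l i k ⊓ L₁.fiber (D.t i) (D.n i)) (E.l i k ⊓ L₂.fiber (D.t i) (D.n i)) ∧
      E.l i k = (E.l i k ⊓ L₁.fiber (D.t i) (D.n i)) ⊔ (E.l i k ⊓ L₂.fiber (D.t i) (D.n i))

/-- Undecomposability. -/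
def Undecomposable : Prop := ¬ E.Decomposable

/-- The stalk at `t_i` of `E_i^{(k)} = ker (E → E|_{n_i[t_i]} / l_{i,k})`. -/
def filtration (i : Fin D.ν) (k : ℕ) : Submodule (localRing (D.t i)) V :=
  ofQuot (E.l i k)

theorem filtration_le (i : Fin D.ν) (k : ℕ) : E.filtration i k ≤ E.stalk (D.t i) :=
  ofQuot_le _

theorem twist_le_filtration (i : Fin D.ν) (k : ℕ) :
    E.twist (D.t i) (D.n i) ≤ E.filtration i k :=
  le_ofQuot (E.twist_le _ _) _

theorem filtration_mono (i : Fin D.ν) (k : ℕ) (hk : k < D.n i) :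
    E.filtration i k ≤ E.filtration i (k + 1) :=
  ofQuot_mono (E.l_le i k hk)

theorem relLength_filtration (i : Fin D.ν) (k : ℕ) (hk : k ≤ D.n i) :
    relLength (E.filtration i k) (E.twist (D.t i) (D.n i)) = k :=
  (relLength_ofQuot _).trans (E.l_length i k hk)

theorem filtration_zero (i : Fin D.ν) : E.filtration i 0 = E.twist (D.t i) (D.n i) := by
  refine le_antisymm ?_ (E.twist_le_filtration i 0)
  have h := E.relLength_filtration i 0 (Nat.zero_le _)
  rw [relLength, Nat.cast_zero, Module.length_eq_zero_iff, Submodule.Quotient.subsingleton_iff] at h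
  intro v hv
  have : (⟨v, hv⟩ : E.filtration i 0) ∈ (E.twist (D.t i) (D.n i)).submoduleOf (E.filtration i 0) :=
    h ▸ Submodule.mem_top
  exact this

theorem exists_basis_filtration (i : Fin D.ν) (k : ℕ) :
    ∃ b : Module.Basis (Fin 2) FunField V,
      E.filtration i k = Submodule.span (localRing (D.t i)) (Set.range b) := by
  refine exists_basis_of_lattice E.finrank_eq _ (E.fg_of_le (E.filtration_le i k)) ?_
  rw [eq_top_iff]
  refine le_trans ?_ (Submodule.span_mono (E.twist_le_filtration i k))
  obtain ⟨b, hb⟩ := E.exists_basis (D.t i)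
  obtain ⟨ϖ, hϖ⟩ := IsDiscreteValuationRing.exists_irreducible (localRing (D.t i))
  have h0 : ((ϖ ^ D.n i : localRing (D.t i)) : FunField) ≠ 0 :=
    fun h => pow_ne_zero _ hϖ.ne_zero (Subtype.ext h)
  rw [← b.span_eq, Submodule.span_le]
  rintro _ ⟨j, rfl⟩
  refine (Submodule.smul_mem_iff _ h0).mp (Submodule.subset_span ?_)
  have h1 : ϖ ^ D.n i ∈ IsLocalRing.maximalIdeal (localRing (D.t i)) ^ D.n i :=
    Ideal.pow_mem_pow ((IsLocalRing.mem_maximalIdeal _).mpr hϖ.not_isUnit) _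
  have h2 : b j ∈ E.stalk (D.t i) := hb ▸ Submodule.subset_span ⟨j, rfl⟩
  exact Submodule.smul_mem_smul h1 h2

/-- The underlying bundle `E'_{i₀} = E_{i₀}^{(n_{i₀})}` of the elementary transformation. -/
def elmBundle (i₀ : Fin D.ν) : VectorBundle V 2 :=
  E.modify (D.t i₀) (E.filtration i₀ (D.n i₀)) (E.exists_basis_filtration i₀ (D.n i₀))

open Classical in
theorem elmBundle_stalk_self (i₀ : Fin D.ν) :
    (E.elmBundle i₀).stalk (D.t i₀) = E.filtration i₀ (D.n i₀) := by
  exact Function.update_self (D.t i₀) (E.filtration i₀ (D.n i₀)) E.stalk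

open Classical in
theorem elmBundle_stalk_of_ne (i₀ : Fin D.ν) {p : Point} (hp : p ≠ D.t i₀) :
    (E.elmBundle i₀).stalk p = E.stalk p := by
  exact Function.update_of_ne hp (E.filtration i₀ (D.n i₀)) E.stalk

theorem elmBundle_le (i₀ : Fin D.ν) (p : Point) : (E.elmBundle i₀).stalk p ≤ E.stalk p := by
  by_cases hp : p = D.t i₀
  · subst hp
    rw [elmBundle_stalk_self]
    exact E.filtration_le _ _
  · rw [E.elmBundle_stalk_of_ne i₀ hp]

/-- The stalk at `t_i` of the new filtration: `(E'_{i₀})^{(n_{i₀}-k)} = E_{i₀}^{(k)}(-k[t_{i₀}])` at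
`i₀`, and the old one at the other indices. -/
def elmFiltration (i₀ i : Fin D.ν) (k : ℕ) : Submodule (localRing (D.t i)) V :=
  if i = i₀ then
    IsLocalRing.maximalIdeal (localRing (D.t i)) ^ (D.n i - k) • E.filtration i (D.n i - k)
  else E.filtration i k

theorem elmFiltration_spec (i₀ i : Fin D.ν) :
    (∀ k, k < D.n i → E.elmFiltration i₀ i k ≤ E.elmFiltration i₀ i (k + 1)) ∧
    (∀ k, k ≤ D.n i → E.elmFiltration i₀ i k ≤ (E.elmBundle i₀).stalk (D.t i)) ∧
    (∀ k, k ≤ D.n i →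
      relLength (E.elmFiltration i₀ i k) ((E.elmBundle i₀).twist (D.t i) (D.n i)) = k) := by
  by_cases hi : i = i₀
  · subst hi
    have hc := elm_chain (K := FunField) (n := D.n i) (E.filtration i)
      (fun k _ => E.exists_basis_filtration i k) (E.filtration_mono i)
      (fun k hk => by rw [E.filtration_zero]; exact E.relLength_filtration i k hk)
    have hmono : ∀ j k, j ≤ k → k ≤ D.n i → E.filtration i j ≤ E.filtration i k := by
      intro j k hjk
      induction k, hjk using Nat.le_induction with
      | base => intro _; exact le_rfl
      | succ k _ ih => intro h; exact (ih (by omega)).trans (E.filtration_mono i k (by omega))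
    simp only [elmFiltration, if_true, VectorBundle.twist, elmBundle_stalk_self]
    refine ⟨fun k hk => ?_, fun k hk => ?_, fun k hk => hc.2 k (D.n i - k) (by omega)⟩
    · have := hc.1 (D.n i - (k + 1)) (by omega)
      rwa [show D.n i - (k + 1) + 1 = D.n i - k by omega] at this
    · exact Submodule.smul_le_right.trans (hmono _ _ (by omega) le_rfl)
  · have hne : D.t i ≠ D.t i₀ := fun h => hi (D.t_injective h)
    simp only [elmFiltration, if_neg hi, VectorBundle.twist, E.elmBundle_stalk_of_ne i₀ hne]
    exact ⟨E.filtration_mono i, fun k _ => E.filtration_le i k, E.relLength_filtration i⟩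

/-- The elementary transformation at `n_{i₀}[t_{i₀}]`, with the refined parabolic structure
`l'_{i₀,k} = (E'_{i₀})^{(k)} / (E'_{i₀})^{(0)}` at `i₀` (where `(E'_{i₀})^{(0)} = E'_{i₀}(-n_{i₀}[t_{i₀}])`)
and the same refined parabolic structure as `E` at the other indices. -/
def elm (i₀ : Fin D.ν) : RefinedParabolicBundle V D where
  toVectorBundle := E.elmBundle i₀
  l i k := toQuot _ _ (E.elmFiltration i₀ i k)
  l_le i k hk := toQuot_mono ((E.elmFiltration_spec i₀ i).1 k hk)
  l_length i k hk := (length_toQuot ((E.elmFiltration_spec i₀ i).2.1 k hk)).trans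
    ((E.elmFiltration_spec i₀ i).2.2 k hk)

/-- The line subbundle of the elementary transformation induced by `L` via `E'_{i₀} ⊆ E`. -/
def elmSub (i₀ : Fin D.ν) (L : LineSubbundle E.toVectorBundle) :
    LineSubbundle (E.elm i₀).toVectorBundle :=
  L.restrict (E.elmBundle i₀) (E.elmBundle_le i₀)

end RefinedParabolicBundle

end ProjectiveLine

end RefinedParabolic

end

/-! Everything happens at the point t of index i₀, inside the generic fibre V. Write n for n_{i₀},
S_j for the sum of the first j signs ε_k(L) at i₀, and a_k for the jumps there. By saturation a line
subbundle L is the same as a line G in V, with stalks E_p ∩ G, so the line subbundles of E and of E'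
correspond bijectively. The jump a_k is the length of (E^{(k)} ∩ G) / (E^{(k-1)} ∩ G).

The new chain is E'^{(k)} = 𝔪^{n-k} E^{(n-k)}. In 𝔪 E^{(j+1)} ⊆ E^{(j)} ⊆ E^{(j+1)}, intersecting
with G gives a chain of total length one, since E^{(j+1)} ∩ G is a lattice of rank one. Hence a'_k =
1 - a_{n-k+1} (`jump_elm_add_jump`). Counting colengths gives deg E' = deg E - n (`degree_elm`) and
deg L' = deg L - n + ∑ a_k (`degree_elmSub`).

Stability: the weighted sum at i₀ changes by 2∑ a_k - n, which cancels the change of deg E - 2 deg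
L.

Tameness: max(N, 0) is the maximum of S_j over 0 ≤ j ≤ n, and S'_j = S_{n-j} - S_n. So max(N, 0)
drops by S_n = n - 2∑ a_k (`max_N_elm`), exactly as -deg E + 2 deg L does.

Undecomposability: a decomposition is a pair of lines splitting every stalk and every E^{(k)}
(`decomposable_iff`). Splitting is insensitive to powers of 𝔪, so a decomposition of the transform
decomposes E. -/

noncomputable section

namespace RefinedParabolic

/-! ### Lengths of subquotients, and submodules of a quotient. -/

section Length

variable {O : Type*} [CommRing O] {M : Type*} [AddCommGroup M] [Module O M]

theorem relLength_inf_right (A B : Submodule O M) : relLength A (A ⊓ B) = relLength A B := by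
  have : (A ⊓ B).submoduleOf A = B.submoduleOf A := by
    ext x; exact ⟨fun h => h.2, fun h => ⟨x.2, h⟩⟩
  unfold relLength
  rw [this]

theorem relLength_inf_left (A B : Submodule O M) : relLength A (B ⊓ A) = relLength A B := by
  rw [inf_comm, relLength_inf_right]

/-- The kernel of A → f(A)/f(B) is B + (A ∩ ker f), which is B here. This covers both quotient maps
and embeddings. -/
theorem relLength_map_of_ker_le {N : Type*} [AddCommGroup N] [Module O N] (f : M →ₗ[O] N)
    {A B : Submodule O M} (hBA : B ≤ A) (hker : ∀ x ∈ A, f x = 0 → x ∈ B) :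
    relLength (A.map f) (B.map f) = relLength A B := by
  let φ : A →ₗ[O] A.map f ⧸ (B.map f).submoduleOf (A.map f) :=
    ((B.map f).submoduleOf (A.map f)).mkQ ∘ₗ f.submoduleMap A
  have hs : Function.Surjective φ :=
    (Submodule.mkQ_surjective _).comp (f.submoduleMap_surjective A)
  have hk : LinearMap.ker φ = B.submoduleOf A := by
    ext x
    rw [LinearMap.mem_ker]
    refine (Submodule.Quotient.mk_eq_zero _).trans ?_
    constructor
    · rintro ⟨b, hb, h⟩
      have h' : f b = f x := h
      have hx : (x : M) - b ∈ B := hker _ (A.sub_mem x.2 (hBA hb)) (by rw [map_sub, h', sub_self])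
      show (x : M) ∈ B
      simpa using B.add_mem hx hb
    · intro hx
      exact ⟨x, hx, rfl⟩
  unfold relLength
  rw [← hk]
  exact (φ.quotKerEquivOfSurjective hs).symm.length_eq

theorem relLength_toQuot {A C N N' : Submodule O M} (hN : N' ≤ N) (hNA : N ≤ A)
    (hC : C ⊓ N ≤ N') : relLength (toQuot A C N) (toQuot A C N') = relLength N N' := by
  have h1 : (N.submoduleOf A).map A.subtype = N := by
    rw [Submodule.submoduleOf, Submodule.map_comap_subtype]; exact inf_eq_right.mpr hNA
  have h2 : (N'.submoduleOf A).map A.subtype = N' := by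
    rw [Submodule.submoduleOf, Submodule.map_comap_subtype]; exact inf_eq_right.mpr (hN.trans hNA)
  have hle : N'.submoduleOf A ≤ N.submoduleOf A := fun x hx => hN hx
  unfold toQuot
  rw [relLength_map_of_ker_le _ hle]
  · conv_rhs => rw [← h1, ← h2]
    refine (relLength_map_of_ker_le _ hle fun x _ hx => ?_).symm
    have : x = 0 := Subtype.ext hx
    rw [this]; exact Submodule.zero_mem _
  · intro x hx h
    exact hC ⟨(Submodule.Quotient.mk_eq_zero (C.submoduleOf A)).mp h, hx⟩

/-- Images need not commute with intersections; they do here because `ofQuot l` is the full preimage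
of `l`. -/
theorem inf_toQuot {A C N : Submodule O M} (l : Submodule O (A ⧸ C.submoduleOf A)) :
    l ⊓ toQuot A C N = toQuot A C (ofQuot l ⊓ N) := by
  apply le_antisymm
  · rintro _ ⟨hy, x, hx, rfl⟩
    exact ⟨x, ⟨⟨x, hy, rfl⟩, hx⟩, rfl⟩
  · rintro _ ⟨x, ⟨⟨z, hz, hzx⟩, hx⟩, rfl⟩
    have : z = x := Subtype.ext hzx
    subst this
    exact ⟨hz, z, hx, rfl⟩

theorem ofQuot_toQuot {A C N : Submodule O M} (hC : C ≤ N) (hN : N ≤ A) :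
    ofQuot (toQuot A C N) = N := by
  apply le_antisymm
  · rintro _ ⟨x, ⟨y, hy, hxy⟩, rfl⟩
    have h : ((y - x : A) : M) ∈ C := (Submodule.Quotient.eq (C.submoduleOf A)).mp hxy
    have h2 : (x : M) = y - (y - x : A) := by simp
    rw [Submodule.subtype_apply, h2]
    exact N.sub_mem hy (hC h)
  · intro x hx
    exact ⟨⟨x, hN hx⟩, ⟨⟨x, hN hx⟩, hx, rfl⟩, rfl⟩

theorem toQuot_sup {A C N N' : Submodule O M} (hN : N ≤ A) (hN' : N' ≤ A) :
    toQuot A C (N ⊔ N') = toQuot A C N ⊔ toQuot A C N' := by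
  rw [toQuot, toQuot, toQuot, ← Submodule.map_sup, Submodule.submoduleOf_sup_of_le hN hN']

/-- Additivity of lengths along a chain. -/
theorem relLength_eq_sum_range (F : ℕ → Submodule O M) {n : ℕ}
    (hF : ∀ k, k < n → F k ≤ F (k + 1)) :
    F 0 ≤ F n ∧ relLength (F n) (F 0) = ∑ k ∈ Finset.range n, relLength (F (k + 1)) (F k) := by
  induction n with
  | zero => exact ⟨le_rfl, by rw [relLength_self]; rfl⟩
  | succ n ih =>
    obtain ⟨h1, h2⟩ := ih fun k hk => hF k (by omega)
    have h3 := hF n (by omega)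
    exact ⟨h1.trans h3, by rw [relLength_add h1 h3, h2, Finset.sum_range_succ]⟩

end Length

/-! ### Lattices over a discrete valuation ring and their intersections with a line. -/

section DVR

variable {O K V : Type*} [CommRing O] [IsDomain O] [IsDiscreteValuationRing O] [Field K]
  [Algebra O K] [IsFractionRing O K] [AddCommGroup V] [Module K V] [Module O V]
  [IsScalarTower O K V]

local notation "𝔪" => IsLocalRing.maximalIdeal O

/-- Multiplication by ϖ^j is bijective on V and maps the K-subspace G onto itself. -/
theorem pow_smul_inf_restrictScalars (j : ℕ) (A : Submodule O V) (G : Submodule K V) :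
    𝔪 ^ j • A ⊓ G.restrictScalars O = 𝔪 ^ j • (A ⊓ G.restrictScalars O) := by
  obtain ⟨ϖ, hϖ⟩ := IsDiscreteValuationRing.exists_irreducible O
  have h0 : algebraMap O K (ϖ ^ j) ≠ 0 := by
    rw [Ne, IsFractionRing.to_map_eq_zero_iff]
    exact pow_ne_zero _ hϖ.ne_zero
  rw [hϖ.maximalIdeal_eq, Ideal.span_singleton_pow, Submodule.ideal_span_singleton_smul,
    Submodule.ideal_span_singleton_smul]
  ext v
  simp only [Submodule.mem_smul_pointwise_iff_exists, Submodule.mem_inf,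
    Submodule.restrictScalars_mem]
  constructor
  · rintro ⟨⟨a, ha, rfl⟩, h⟩
    rw [← algebraMap_smul K (ϖ ^ j) a, Submodule.smul_mem_iff _ h0] at h
    exact ⟨a, ⟨ha, h⟩, rfl⟩
  · rintro ⟨a, ⟨ha, h⟩, rfl⟩
    refine ⟨⟨a, ha, rfl⟩, ?_⟩
    rw [← algebraMap_smul K (ϖ ^ j) a]
    exact G.smul_mem _ h

theorem pow_smul_injective (K : Type*) {V : Type*} [Field K] [Algebra O K] [IsFractionRing O K]
    [AddCommGroup V] [Module K V] [Module O V] [IsScalarTower O K V] (j : ℕ) :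
    Function.Injective fun A : Submodule O V => 𝔪 ^ j • A := by
  obtain ⟨e, he⟩ := exists_pow_smul_eq_map O K V j
  intro A B h
  simp only [he] at h
  exact Submodule.map_injective_of_injective e.injective h

theorem relLength_pow_smul (K : Type*) {V : Type*} [Field K] [Algebra O K] [IsFractionRing O K]
    [AddCommGroup V] [Module K V] [Module O V] [IsScalarTower O K V] (j : ℕ)
    (A B : Submodule O V) : relLength (𝔪 ^ j • A) (𝔪 ^ j • B) = relLength A B := by
  obtain ⟨e, he⟩ := exists_pow_smul_eq_map O K V j
  rw [he, he, relLength_map]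

theorem pow_smul_le_pow_smul (A : Submodule O V) (k : ℕ) : 𝔪 ^ (k + 1) • A ≤ 𝔪 ^ k • A :=
  Submodule.smul_mono_left (Ideal.pow_le_pow_right (Nat.le_succ k))

/-- If `A / 𝔪 A` has length `r`, then `A / 𝔪ⁿ A` has length `r * n`. -/
theorem relLength_pow_smul_self (K : Type*) {V : Type*} [Field K] [Algebra O K]
    [IsFractionRing O K] [AddCommGroup V] [Module K V] [Module O V] [IsScalarTower O K V]
    {A : Submodule O V} {r : ℕ} (hA : relLength A (𝔪 • A) = r) (n : ℕ) :
    relLength A (𝔪 ^ n • A) = (r * n : ℕ) := by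
  induction n with
  | zero => rw [pow_zero, Ideal.one_eq_top, Submodule.top_smul, relLength_self]; rfl
  | succ n ih =>
    rw [relLength_add (pow_smul_le_pow_smul A n) Submodule.smul_le_right, ih, pow_succ,
      Submodule.mul_smul, relLength_pow_smul K, hA, mul_add, mul_one, add_comm, Nat.cast_add]

/-- Clear denominators in the coordinates of finitely many generators; a common denominator is a
unit times a power of ϖ. -/
theorem exists_pow_smul_le {r : ℕ} {A B : Submodule O V} (b : Module.Basis (Fin r) K V)
    (hA : A.FG) (hB : B = Submodule.span O (Set.range b)) : ∃ n : ℕ, 𝔪 ^ n • A ≤ B := by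
  obtain ⟨ϖ, hϖ⟩ := IsDiscreteValuationRing.exists_irreducible O
  have key : ∀ v : V, ∃ n : ℕ, 𝔪 ^ n • Submodule.span O {v} ≤ B := by
    intro v
    obtain ⟨a, ha⟩ := IsLocalization.exist_integer_multiples_of_finite (nonZeroDivisors O)
      fun i => b.repr v i
    have ha0 : (a : O) ≠ 0 := nonZeroDivisors.ne_zero a.2
    obtain ⟨n, u, hu⟩ := IsDiscreteValuationRing.eq_unit_mul_pow_irreducible ha0 hϖ
    refine ⟨n, ?_⟩
    have hmem : (a : O) • v ∈ B := by
      rw [hB, b.mem_span_iff_repr_mem O]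
      intro i
      obtain ⟨c, hc⟩ := ha i
      refine ⟨c, ?_⟩
      rw [hc, ← algebraMap_smul K (a : O) v, map_smul, Finsupp.smul_apply, algebraMap_smul]
    rw [hϖ.maximalIdeal_eq, Ideal.span_singleton_pow, Submodule.smul_le]
    intro c hc w hw
    obtain ⟨d, rfl⟩ := Ideal.mem_span_singleton.mp hc
    obtain ⟨f, rfl⟩ := Submodule.mem_span_singleton.mp hw
    have : (ϖ ^ n * d) • f • v = (d * f * (u⁻¹ : Oˣ)) • (a : O) • v := by
      rw [smul_smul, smul_smul, hu]
      congr 1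
      calc ϖ ^ n * d * f = d * f * ((u⁻¹ : Oˣ) * u) * ϖ ^ n := by
            rw [Units.inv_mul]; ring
        _ = _ := by ring
    rw [this]
    exact B.smul_mem _ hmem
  induction A, hA using Submodule.fg_induction with
  | singleton v => exact key v
  | sup M₁ M₂ _ _ h₁ h₂ =>
    obtain ⟨n₁, h₁⟩ := h₁
    obtain ⟨n₂, h₂⟩ := h₂
    refine ⟨n₁ + n₂, ?_⟩
    rw [Submodule.smul_sup, sup_le_iff]
    exact ⟨(Submodule.smul_mono_left (Ideal.pow_le_pow_right (by omega))).trans h₁,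
      (Submodule.smul_mono_left (Ideal.pow_le_pow_right (by omega))).trans h₂⟩

/-- A ∩ B contains some 𝔪ⁿA, and A / 𝔪ⁿA has finite length rn. Finiteness matters because `index`
uses `toNat`, which sends ⊤ to 0. -/
theorem relLength_ne_top {r s : ℕ} {A B : Submodule O V} (b : Module.Basis (Fin r) K V)
    (c : Module.Basis (Fin s) K V) (hA : A = Submodule.span O (Set.range b))
    (hB : B = Submodule.span O (Set.range c)) : relLength A B ≠ ⊤ := by
  obtain ⟨n, hn⟩ := exists_pow_smul_le (A := A) c
    (hA ▸ Submodule.fg_span (Set.finite_range b)) hB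
  have h1 : relLength A (𝔪 • A) = r := by rw [hA]; exact relLength_smul_self b
  have h2 := relLength_pow_smul_self K h1 n
  have h3 := relLength_add (A := A) (B := A ⊓ B) (C := 𝔪 ^ n • A)
    (le_inf Submodule.smul_le_right hn) inf_le_left
  rw [relLength_inf_right, h2] at h3
  intro h
  rw [h, add_top] at h3
  exact ENat.natCast_ne_top _ h3

/-- A ∩ G is a lattice in the one-dimensional space G, hence free on one generator. -/
theorem relLength_inf_restrictScalars {A : Submodule O V} (b : Module.Basis (Fin 2) K V)
    (hA : A = Submodule.span O (Set.range b)) {G : Submodule K V}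
    (hG : Module.finrank K G = 1) :
    relLength (A ⊓ G.restrictScalars O) (𝔪 • (A ⊓ G.restrictScalars O)) = 1 := by
  set ι : G →ₗ[O] V := G.subtype.restrictScalars O with hι
  have hinj : Function.Injective ι := Subtype.val_injective
  have hmap : (A.comap ι).map ι = A ⊓ G.restrictScalars O := by
    rw [Submodule.map_comap_eq, inf_comm]
    congr 1
    ext v
    exact ⟨fun ⟨x, hx⟩ => hx ▸ x.2, fun hv => ⟨⟨v, hv⟩, rfl⟩⟩
  have hfg : (A.comap ι).FG := by
    apply Submodule.fg_of_fg_map_injective ι hinj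
    rw [hmap]
    have : Module.Finite O A := Module.Finite.iff_fg.mpr (hA ▸ Submodule.fg_span
      (Set.finite_range b))
    have : IsNoetherian O (A ⊓ G.restrictScalars O : Submodule O V) :=
      isNoetherian_of_le (inf_le_left : _ ≤ A)
    exact Module.Finite.iff_fg.mp inferInstance
  have hspan : Submodule.span K (A.comap ι : Set G) = ⊤ := by
    rw [eq_top_iff]
    rintro w -
    obtain ⟨n, hn⟩ := exists_pow_smul_le (A := Submodule.span O {(w : V)}) b
      (Submodule.fg_span_singleton _) hA
    obtain ⟨ϖ, hϖ⟩ := IsDiscreteValuationRing.exists_irreducible O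
    have h0 : algebraMap O K (ϖ ^ n) ≠ 0 := by
      rw [Ne, IsFractionRing.to_map_eq_zero_iff]
      exact pow_ne_zero _ hϖ.ne_zero
    refine (Submodule.smul_mem_iff _ h0).mp (Submodule.subset_span ?_)
    rw [SetLike.mem_coe, Submodule.mem_comap, algebraMap_smul, map_smul]
    exact hn (Submodule.smul_mem_smul (Ideal.pow_mem_pow
      ((IsLocalRing.mem_maximalIdeal _).mpr hϖ.not_isUnit) _) (Submodule.mem_span_singleton_self _))
  obtain ⟨c, hc⟩ := exists_basis_of_lattice hG _ hfg hspan
  rw [← hmap, ← Submodule.map_smul'', relLength_map_of_ker_le ι Submodule.smul_le_right]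
  · rw [hc]; exact_mod_cast relLength_smul_self c
  · intro x _ hx
    have : x = 0 := hinj (hx.trans (map_zero ι).symm)
    rw [this]; exact Submodule.zero_mem _

/-- The jumps of a chain of lattices along a line and of the reversed chain are complementary. -/
theorem relLength_inf_add_reverse {A B : Submodule O V} (hle : A ≤ B) (hlen : relLength B A = 1)
    (b : Module.Basis (Fin 2) K V) (hB : B = Submodule.span O (Set.range b)) {G : Submodule K V}
    (hG : Module.finrank K G = 1) (j : ℕ) :
    relLength (𝔪 ^ j • A ⊓ G.restrictScalars O) (𝔪 ^ (j + 1) • B ⊓ G.restrictScalars O) +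
      relLength (B ⊓ G.restrictScalars O) (A ⊓ G.restrictScalars O) = 1 := by
  -- Once the factor 𝔪^j is removed, the two terms are the successive lengths in 𝔪(B ∩ G) ⊆ A ∩ G ⊆
  -- B ∩ G.
  rw [pow_smul_inf_restrictScalars, pow_smul_inf_restrictScalars, pow_succ, Submodule.mul_smul,
    relLength_pow_smul K, ← relLength_add, relLength_inf_restrictScalars b hB hG]
  · refine le_inf ((smul_mono_right _ inf_le_left).trans (maximalIdeal_smul_le hlen))
      (Submodule.smul_le_right.trans inf_le_right)
  · exact inf_le_inf_right _ hle

end DVR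

/-! ### Degrees under a change of one stalk; line subbundles as lines in the generic fibre. -/

section Degree

variable {V : Type*} [AddCommGroup V] [Module FunField V] {r : ℕ}

theorem index_eq_sub {p : Point} {A B C : Submodule (localRing p) V}
    (hA : ∃ b : Module.Basis (Fin r) FunField V, A = Submodule.span (localRing p) (Set.range b))
    (hB : ∃ b : Module.Basis (Fin r) FunField V, B = Submodule.span (localRing p) (Set.range b))
    (hC : ∃ b : Module.Basis (Fin r) FunField V, C = Submodule.span (localRing p) (Set.range b))
    (hBA : B ≤ A) : index B C = index A C - ((relLength A B).toNat : ℤ) := by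
  obtain ⟨a, hA⟩ := hA
  obtain ⟨b, hB⟩ := hB
  obtain ⟨c, hC⟩ := hC
  have hAB : relLength A B ≠ ⊤ := relLength_ne_top a b hA hB
  have hAC : relLength A C ≠ ⊤ := relLength_ne_top a c hA hC
  have hBC : relLength B C ≠ ⊤ := relLength_ne_top b c hB hC
  have hCA : relLength C A ≠ ⊤ := relLength_ne_top c a hC hA
  have hCB : relLength C B ≠ ⊤ := relLength_ne_top c b hC hB
  -- The length of A / (B ∩ C) is computed through B and through A ∩ C, and that of C / (B ∩ C)
  -- through A ∩ C; the common term cancels.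
  have h1 : relLength A (B ⊓ C) = relLength B C + relLength A B := by
    rw [relLength_add inf_le_left hBA, relLength_inf_right]
  have h2 : relLength A (B ⊓ C) = relLength (A ⊓ C) (B ⊓ C) + relLength A C := by
    rw [relLength_add (inf_le_inf_right C hBA) inf_le_left, relLength_inf_right]
  have h3 : relLength C B = relLength (A ⊓ C) (B ⊓ C) + relLength C A := by
    rw [← relLength_inf_left C B, relLength_add (inf_le_inf_right C hBA) inf_le_right,
      relLength_inf_left C A]
  rw [h1] at h2
  have hX : relLength (A ⊓ C) (B ⊓ C) ≠ ⊤ := by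
    intro h
    rw [h, top_add] at h3
    exact hCB h3
  unfold index
  generalize relLength A B = x at *
  generalize relLength A C = y at *
  generalize relLength B C = z at *
  generalize relLength C A = u at *
  generalize relLength C B = v at *
  generalize relLength (A ⊓ C) (B ⊓ C) = w at *
  lift x to ℕ using hAB
  lift y to ℕ using hAC
  lift z to ℕ using hBC
  lift u to ℕ using hCA
  lift v to ℕ using hCB
  lift w to ℕ using hX
  simp only [ENat.toNat_natCast]
  norm_cast at h2 h3
  omega

theorem VectorBundle.exists_basis_ofVectorSpace (E : VectorBundle V r) :
    ∃ c : Module.Basis (Fin r) FunField V,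
      Set.range (Module.Basis.ofVectorSpace FunField V) = Set.range c := by
  obtain ⟨b, -⟩ := E.locally_free .infty
  exact ⟨(Module.Basis.ofVectorSpace FunField V).reindex
    ((Module.Basis.ofVectorSpace FunField V).indexEquiv b), (Module.Basis.range_reindex _ _).symm⟩

/-- Two bases of V span the same lattice at almost every point. Without finite support the `finsum`
defining the degree would default to 0. -/
theorem VectorBundle.finite_support_index (E : VectorBundle V r) :
    (Function.support fun p : Point => index (E.stalk p)
      (Submodule.span (localRing p)
        (Set.range (Module.Basis.ofVectorSpace FunField V)))).Finite := by
  obtain ⟨c, hc⟩ := E.exists_basis_ofVectorSpace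
  obtain ⟨b, U, hU, -, hb⟩ := E.locally_free .infty
  refine (hU.union (finite_span_ne b c)).subset fun p hp => ?_
  by_contra h
  simp only [Set.mem_union, Set.mem_compl_iff, Set.mem_ofPred_eq, not_or, not_not] at h
  apply hp
  simp only [hc, hb p h.1, h.2, index, sub_self]

/-- Shrinking the stalk at one point lowers the degree by the colength. -/
theorem VectorBundle.degree_eq_sub (E E' : VectorBundle V r) (p₀ : Point)
    (hne : ∀ p, p ≠ p₀ → E'.stalk p = E.stalk p) (hle : E'.stalk p₀ ≤ E.stalk p₀) :
    E'.degree = E.degree - ((relLength (E.stalk p₀) (E'.stalk p₀)).toNat : ℤ) := by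
  obtain ⟨c, hc⟩ := E.exists_basis_ofVectorSpace
  have h : E.degree - E'.degree = ((relLength (E.stalk p₀) (E'.stalk p₀)).toNat : ℤ) := by
    unfold VectorBundle.degree
    rw [← finsum_sub_distrib E.finite_support_index E'.finite_support_index,
      finsum_eq_single _ p₀ fun p hp => by rw [hne p hp, sub_self],
      index_eq_sub (E.exists_basis p₀) (E'.exists_basis p₀) ⟨c, by rw [hc]⟩ hle]
    ring
  omega

namespace LineSubbundle

variable {E : VectorBundle V r}

theorem stalk_eq (L : LineSubbundle E) (p : Point) :
    L.stalk p = E.stalk p ⊓ L.generic.restrictScalars (localRing p) :=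
  Submodule.ext fun v => L.mem_stalk p v

/-- Saturation forces each stalk to be the full intersection of the stalk of E with the generic
line. -/
theorem eq_of_generic_eq {L L' : LineSubbundle E} (h : L.generic = L'.generic) : L = L' := by
  have hs : L.stalk = L'.stalk := funext fun p => by rw [L.stalk_eq, L'.stalk_eq, h]
  cases L
  cases L'
  cases h
  cases hs
  rfl

/-- The line subbundle with a given generic fibre. -/
def ofGeneric (E : VectorBundle V r) (G : Submodule FunField V)
    (hG : Module.finrank FunField G = 1) : LineSubbundle E where
  generic := G
  finrank_generic := hG
  stalk p := E.stalk p ⊓ G.restrictScalars (localRing p)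
  stalk_le p := inf_le_left
  span_stalk p := by
    apply le_antisymm
    · exact Submodule.span_le.mpr fun v hv => hv.2
    · intro v hv
      obtain ⟨a, ha, hav⟩ := exists_smul_mem (E.stalk p) (v := v)
        (by rw [E.span_stalk]; exact Submodule.mem_top)
      have h0 : (a : FunField) ≠ 0 := fun h => ha (Subtype.ext h)
      exact (Submodule.smul_mem_iff _ h0).mp
        (Submodule.subset_span ⟨hav, G.smul_mem (a : FunField) hv⟩)
  saturated p a v ha hv hav := by
    have h0 : (a : FunField) ≠ 0 := fun h => ha (Subtype.ext h)
    exact ⟨hv, (G.smul_mem_iff h0).mp hav.2⟩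

/-- This is `VectorBundle.degree_eq_sub` for rank one bundles on the generic line; the embedding of
that line in V preserves lengths. -/
theorem degree_restrict (L : LineSubbundle E) (E' : VectorBundle V r)
    (h : ∀ p, E'.stalk p ≤ E.stalk p) (p₀ : Point)
    (hne : ∀ p, p ≠ p₀ → E'.stalk p = E.stalk p) :
    (L.restrict E' h).degree =
      L.degree - ((relLength (L.stalk p₀) (E'.stalk p₀)).toNat : ℤ) := by
  have hd := VectorBundle.degree_eq_sub L.toVectorBundle (L.restrict E' h).toVectorBundle p₀
    (fun p hp => ?_) (fun v hv => hv.1)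
  · refine hd.trans ?_
    congr 3
    set ι : L.generic →ₗ[localRing p₀] V :=
      L.generic.subtype.restrictScalars (localRing p₀) with hι
    have hinj : Function.Injective ι := Subtype.val_injective
    have hmap : ∀ A : Submodule (localRing p₀) V, A ≤ L.stalk p₀ → (A.comap ι).map ι = A := by
      intro A hA
      apply Submodule.map_comap_eq_self
      intro v hv
      exact ⟨⟨v, ((L.mem_stalk p₀ v).mp (hA hv)).2⟩, rfl⟩
    have hlen := relLength_map_of_ker_le ι (A := (L.stalk p₀).comap ι)
      (B := (L.stalk p₀ ⊓ E'.stalk p₀).comap ι) (Submodule.comap_mono inf_le_left)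
      fun x _ hx => by
        have : x = 0 := hinj (hx.trans (map_zero ι).symm)
        rw [this]; exact Submodule.zero_mem _
    rw [hmap _ le_rfl, hmap _ inf_le_left, relLength_inf_right] at hlen
    exact hlen.symm
  · show ((L.stalk p ⊓ E'.stalk p).comap _ : Submodule (localRing p) L.generic) =
      (L.stalk p).comap _
    rw [hne p hp, inf_eq_left.mpr (L.stalk_le p)]
    rfl

end LineSubbundle

end Degree

/-! ### Jumps and degrees under the elementary transformation. -/

namespace RefinedParabolicBundle

variable {V : Type*} [AddCommGroup V] [Module FunField V] {D : PolarDivisor}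
  (E : RefinedParabolicBundle V D)

local notation "𝔪" p => IsLocalRing.maximalIdeal (localRing p)

theorem filtration_mono_of_le (i : Fin D.ν) {j k : ℕ} (hjk : j ≤ k) (hk : k ≤ D.n i) :
    E.filtration i j ≤ E.filtration i k := by
  induction k, hjk using Nat.le_induction with
  | base => exact le_rfl
  | succ k _ ih => exact (ih (by omega)).trans (E.filtration_mono i k (by omega))

theorem relLength_filtration_succ (i : Fin D.ν) {k : ℕ} (hk : k < D.n i) :
    relLength (E.filtration i (k + 1)) (E.filtration i k) = 1 := by
  have h := relLength_add (E.twist_le_filtration i k) (E.filtration_mono i k hk)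
  rw [E.relLength_filtration i k hk.le, E.relLength_filtration i (k + 1) hk, Nat.cast_add] at h
  exact (ENat.add_right_injective_of_ne_top (ENat.natCast_ne_top k) h).symm

/-- The colength of the last filtration step is `n_i`. -/
theorem relLength_stalk_filtration (i : Fin D.ν) :
    relLength (E.stalk (D.t i)) (E.filtration i (D.n i)) = D.n i := by
  obtain ⟨b, hb⟩ := E.exists_basis (D.t i)
  have h1 : relLength (E.stalk (D.t i)) ((𝔪 (D.t i)) • E.stalk (D.t i)) = (2 : ℕ) := by
    rw [hb]; exact relLength_smul_self b
  -- In rank two the twist has colength 2n_i in the stalk and, by the parabolic structure, n_i in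
  -- the last step; n_i remains.
  have h2 := relLength_pow_smul_self FunField h1 (D.n i)
  have h3 := relLength_add (E.twist_le_filtration i (D.n i)) (E.filtration_le i (D.n i))
  rw [E.relLength_filtration i _ le_rfl] at h3
  have h4 : ((2 * D.n i : ℕ) : ℕ∞) =
      D.n i + relLength (E.stalk (D.t i)) (E.filtration i (D.n i)) := h2.symm.trans h3
  rw [two_mul, Nat.cast_add] at h4
  exact (ENat.add_right_injective_of_ne_top (ENat.natCast_ne_top _) h4).symm

theorem filtration_inf_stalk (L : LineSubbundle E.toVectorBundle) (i : Fin D.ν) (k : ℕ) :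
    E.filtration i k ⊓ L.stalk (D.t i) =
      E.filtration i k ⊓ L.generic.restrictScalars (localRing (D.t i)) := by
  rw [L.stalk_eq, ← inf_assoc, inf_eq_left.mpr (E.filtration_le i k)]

theorem l_inf_fiber (L : LineSubbundle E.toVectorBundle) (i : Fin D.ν) (k : ℕ) :
    E.l i k ⊓ L.fiber (D.t i) (D.n i) = toQuot (E.stalk (D.t i)) (E.twist (D.t i) (D.n i))
      (E.filtration i k ⊓ L.generic.restrictScalars (localRing (D.t i))) :=
  (inf_toQuot _).trans (by rw [← filtration_inf_stalk]; rfl)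

/-- Both filtration steps contain the twist, so their intersections with the line contain the same
part of it and no length is lost in the fibre. Jumps can then be computed with lattices in V. -/
theorem jump_eq (L : LineSubbundle E.toVectorBundle) (i : Fin D.ν) {k : ℕ} (hk : k ≤ D.n i) :
    E.jump L i k = relLength
      (E.filtration i k ⊓ L.generic.restrictScalars (localRing (D.t i)))
      (E.filtration i (k - 1) ⊓ L.generic.restrictScalars (localRing (D.t i))) := by
  rw [jump, l_inf_fiber, l_inf_fiber]
  exact relLength_toQuot (inf_le_inf_right _ (E.filtration_mono_of_le i (by omega) hk))
    (inf_le_left.trans (E.filtration_le i k))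
    (le_inf (inf_le_left.trans (E.twist_le_filtration i _)) (inf_le_right.trans inf_le_right))

theorem elmFiltration_mono_of_le (i₀ i : Fin D.ν) {j k : ℕ} (hjk : j ≤ k) (hk : k ≤ D.n i) :
    E.elmFiltration i₀ i j ≤ E.elmFiltration i₀ i k := by
  induction k, hjk using Nat.le_induction with
  | base => exact le_rfl
  | succ k _ ih => exact (ih (by omega)).trans ((E.elmFiltration_spec i₀ i).1 k (by omega))

theorem elmFiltration_self (i : Fin D.ν) (k : ℕ) : E.elmFiltration i i k =
    (𝔪 (D.t i)) ^ (D.n i - k) • E.filtration i (D.n i - k) := by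
  rw [elmFiltration, if_pos rfl]

theorem elmFiltration_of_ne {i₀ i : Fin D.ν} (hi : i ≠ i₀) (k : ℕ) :
    E.elmFiltration i₀ i k = E.filtration i k := by
  rw [elmFiltration, if_neg hi]

theorem twist_elmBundle_le (i₀ i : Fin D.ν) {k : ℕ} (hk : k ≤ D.n i) :
    (E.elmBundle i₀).twist (D.t i) (D.n i) ≤ E.elmFiltration i₀ i k := by
  by_cases hi : i = i₀
  · subst hi
    refine le_trans (le_of_eq ?_) (E.elmFiltration_mono_of_le i i (Nat.zero_le k) hk)
    rw [elmFiltration_self, VectorBundle.twist, elmBundle_stalk_self, Nat.sub_zero]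
  · have hne : D.t i ≠ D.t i₀ := fun h => hi (D.t_injective h)
    rw [E.elmFiltration_of_ne hi, VectorBundle.twist, E.elmBundle_stalk_of_ne i₀ hne]
    exact E.twist_le_filtration i k

theorem elm_filtration (i₀ i : Fin D.ν) {k : ℕ} (hk : k ≤ D.n i) :
    (E.elm i₀).filtration i k = E.elmFiltration i₀ i k :=
  ofQuot_toQuot (E.twist_elmBundle_le i₀ i hk) ((E.elmFiltration_spec i₀ i).2.1 k hk)

theorem jump_elm_of_ne (L : LineSubbundle E.toVectorBundle) {i₀ i : Fin D.ν} (hi : i ≠ i₀)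
    {k : ℕ} (hk : k ≤ D.n i) : (E.elm i₀).jump (E.elmSub i₀ L) i k = E.jump L i k := by
  rw [jump_eq _ _ _ hk, jump_eq _ _ _ hk, elm_filtration _ _ _ hk,
    elm_filtration _ _ _ (show k - 1 ≤ D.n i by omega), E.elmFiltration_of_ne hi,
    E.elmFiltration_of_ne hi]
  rfl

/-- The heart of the argument: `relLength_inf_add_reverse` for E^{(n-k)} ⊆ E^{(n-k+1)}, with
exponent n - k. -/
theorem jump_elm_add_jump (L : LineSubbundle E.toVectorBundle) (i : Fin D.ν) {k : ℕ}
    (hk1 : 1 ≤ k) (hk : k ≤ D.n i) :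
    (E.elm i).jump (E.elmSub i L) i k + E.jump L i (D.n i - k + 1) = 1 := by
  obtain ⟨b, hb⟩ := E.exists_basis_filtration i (D.n i - k + 1)
  rw [jump_eq _ _ _ hk, jump_eq _ _ _ (by omega : D.n i - k + 1 ≤ D.n i),
    elm_filtration _ _ _ hk, elm_filtration _ _ _ (show k - 1 ≤ D.n i by omega),
    elmFiltration_self, elmFiltration_self, show D.n i - (k - 1) = D.n i - k + 1 by omega,
    Nat.add_sub_cancel]
  exact relLength_inf_add_reverse (E.filtration_mono i _ (by omega))
    (E.relLength_filtration_succ i (by omega)) b hb L.finrank_generic _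

theorem jump_eq_zero_or_one (L : LineSubbundle E.toVectorBundle) (i : Fin D.ν) {k : ℕ}
    (hk1 : 1 ≤ k) (hk : k ≤ D.n i) : E.jump L i k = 0 ∨ E.jump L i k = 1 := by
  -- The reflected index is chosen so that its own reflection is `k`; two lengths with sum 1 are
  -- each at most 1.
  have h := E.jump_elm_add_jump L i (k := D.n i - k + 1) (by omega) (by omega)
  rw [show D.n i - (D.n i - k + 1) + 1 = k by omega] at h
  have hle : E.jump L i k ≤ 1 := h ▸ le_add_self
  rcases eq_or_ne (E.jump L i k) 0 with h0 | h0
  · exact Or.inl h0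
  · exact Or.inr (le_antisymm hle (Order.one_le_iff_ne_zero.mpr h0))

/-- The jump of `L`, as an integer. -/
def jumpInt (L : LineSubbundle E.toVectorBundle) (i : Fin D.ν) (k : ℕ) : ℤ :=
  (E.jump L i k).toNat

/-- As jumps are 0 or 1, the sign is an affine function of the jump, and sums of signs become sums
of jumps. -/
theorem eps_eq (L : LineSubbundle E.toVectorBundle) (i : Fin D.ν) {k : ℕ}
    (hk1 : 1 ≤ k) (hk : k ≤ D.n i) : E.eps L i k = 1 - 2 * E.jumpInt L i k := by
  rcases E.jump_eq_zero_or_one L i hk1 hk with h | h <;> simp [eps, jumpInt, h]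

theorem jumpInt_elm_of_ne (L : LineSubbundle E.toVectorBundle) {i₀ i : Fin D.ν} (hi : i ≠ i₀)
    {k : ℕ} (hk : k ≤ D.n i) : (E.elm i₀).jumpInt (E.elmSub i₀ L) i k = E.jumpInt L i k := by
  rw [jumpInt, jumpInt, E.jump_elm_of_ne L hi hk]

theorem jumpInt_elm (L : LineSubbundle E.toVectorBundle) (i : Fin D.ν) {k : ℕ}
    (hk1 : 1 ≤ k) (hk : k ≤ D.n i) :
    (E.elm i).jumpInt (E.elmSub i L) i k = 1 - E.jumpInt L i (D.n i - k + 1) := by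
  have h := E.jump_elm_add_jump L i hk1 hk
  rw [jumpInt, jumpInt]
  rcases E.jump_eq_zero_or_one L i (k := D.n i - k + 1) (by omega) (by omega) with h0 | h0
  · rw [h0, add_zero] at h
    simp [h, h0]
  · rcases (E.elm i).jump_eq_zero_or_one (E.elmSub i L) i hk1 hk with h1 | h1
    · simp [h0, h1]
    · rw [h0, h1] at h
      exact absurd h (by decide)

theorem filtration_zero_inf (L : LineSubbundle E.toVectorBundle) (i : Fin D.ν) :
    E.filtration i 0 ⊓ L.generic.restrictScalars (localRing (D.t i)) =
      (𝔪 (D.t i)) ^ D.n i • L.stalk (D.t i) := by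
  rw [filtration_zero, VectorBundle.twist, pow_smul_inf_restrictScalars, ← L.stalk_eq]

/-- The colength of `L ∩ E'` in `L`. -/
theorem relLength_line (L : LineSubbundle E.toVectorBundle) (i : Fin D.ν) :
    ((relLength (L.stalk (D.t i)) (E.filtration i (D.n i))).toNat : ℤ) =
      D.n i - ∑ k ∈ Finset.Icc 1 (D.n i), E.jumpInt L i k := by
  -- The chain M climbs from 𝔪^n L to L ∩ E^{(n)}, its steps being the jumps. As L / 𝔪^n L has
  -- length n, the colength of its top in L is n minus their sum.
  set M : ℕ → Submodule (localRing (D.t i)) V := fun k =>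
    E.filtration i k ⊓ L.generic.restrictScalars (localRing (D.t i)) with hM
  obtain ⟨h0, hsum⟩ := relLength_eq_sum_range M (n := D.n i)
    fun k hk => inf_le_inf_right _ (E.filtration_mono i k hk)
  obtain ⟨b, hb⟩ := E.exists_basis (D.t i)
  have h1 : relLength (L.stalk (D.t i)) ((𝔪 (D.t i)) • L.stalk (D.t i)) = (1 : ℕ) := by
    rw [L.stalk_eq]
    exact_mod_cast relLength_inf_restrictScalars b hb L.finrank_generic
  have h2 := relLength_pow_smul_self FunField h1 (D.n i)
  have hn : M (D.n i) ≤ L.stalk (D.t i) := by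
    rw [L.stalk_eq]; exact inf_le_inf_right _ (E.filtration_le i _)
  have h3 := relLength_add h0 hn
  have hM0 : M 0 = (𝔪 (D.t i)) ^ D.n i • L.stalk (D.t i) := E.filtration_zero_inf L i
  have hMn : relLength (L.stalk (D.t i)) (M (D.n i)) =
      relLength (L.stalk (D.t i)) (E.filtration i (D.n i)) := by
    rw [← relLength_inf_left _ (E.filtration i (D.n i)), E.filtration_inf_stalk L]
  have h4 : ∑ k ∈ Finset.range (D.n i), relLength (M (k + 1)) (M k) =
      ((∑ k ∈ Finset.range (D.n i), (E.jump L i (k + 1)).toNat : ℕ) : ℕ∞) := by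
    rw [Nat.cast_sum]
    refine Finset.sum_congr rfl fun k hk => ?_
    have hk' : k + 1 ≤ D.n i := Finset.mem_range.mp hk
    have hj := E.jump_eq L i hk'
    rw [Nat.add_sub_cancel] at hj
    rw [show relLength (M (k + 1)) (M k) = E.jump L i (k + 1) from hj.symm]
    rcases E.jump_eq_zero_or_one L i (by omega) hk' with h | h <;> simp [h]
  have h5 : ∑ k ∈ Finset.Icc 1 (D.n i), E.jumpInt L i k =
      ((∑ k ∈ Finset.range (D.n i), (E.jump L i (k + 1)).toNat : ℕ) : ℤ) := by
    rw [Nat.cast_sum, Finset.range_eq_Ico, Finset.sum_Ico_add' (fun k =>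
      (((E.jump L i k).toNat : ℕ) : ℤ)) 0 (D.n i) 1, zero_add, Finset.Ico_add_one_right_eq_Icc]
    rfl
  rw [h5]
  rw [hM0, h2, ← hM0, hsum, h4, hMn, one_mul] at h3
  generalize relLength (L.stalk (D.t i)) (E.filtration i (D.n i)) = x at *
  have hx : x ≠ ⊤ := by
    rintro rfl
    rw [add_top] at h3
    exact ENat.natCast_ne_top _ h3
  lift x to ℕ using hx
  rw [ENat.toNat_natCast]
  norm_cast at h3
  omega

theorem degree_elm (i₀ : Fin D.ν) : (E.elm i₀).degree = E.degree - D.n i₀ := by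
  have h := VectorBundle.degree_eq_sub E.toVectorBundle (E.elmBundle i₀) (D.t i₀)
    (fun p hp => E.elmBundle_stalk_of_ne i₀ hp) (E.elmBundle_le i₀ _)
  rw [elmBundle_stalk_self, relLength_stalk_filtration, ENat.toNat_natCast] at h
  exact h

theorem degree_elmSub (i₀ : Fin D.ν) (L : LineSubbundle E.toVectorBundle) :
    (E.elmSub i₀ L).degree =
      L.degree - D.n i₀ + ∑ k ∈ Finset.Icc 1 (D.n i₀), E.jumpInt L i₀ k := by
  have h := L.degree_restrict (E.elmBundle i₀) (E.elmBundle_le i₀) (D.t i₀)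
    (fun p hp => E.elmBundle_stalk_of_ne i₀ hp)
  rw [elmBundle_stalk_self, relLength_line] at h
  refine h.trans ?_
  ring

end RefinedParabolicBundle

/-! ### Invariance of the stability index. -/

theorem sum_Icc_reflect {R : Type*} [AddCommMonoid R] (f : ℕ → R) (n : ℕ) :
    ∑ k ∈ Finset.Icc 1 n, f (n - k + 1) = ∑ k ∈ Finset.Icc 1 n, f k := by
  refine Finset.sum_nbij' (fun k => n - k + 1) (fun k => n - k + 1) ?_ ?_ ?_ ?_ fun _ _ => rfl <;>
  · intro k hk
    simp only [Finset.mem_Icc] at *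
    omega

namespace RefinedParabolicBundle

variable {V : Type*} [AddCommGroup V] [Module FunField V] {D : PolarDivisor}
  (E : RefinedParabolicBundle V D)

/-- The stability index is invariant under elementary transformations. -/
theorem stab_elm (i₀ : Fin D.ν) (W : Weights D) (L : LineSubbundle E.toVectorBundle) :
    E.stab W L = (E.elm i₀).stab (W.elm i₀) (E.elmSub i₀ L) := by
  have hstab : ∀ (E : RefinedParabolicBundle V D) (W : Weights D)
      (L : LineSubbundle E.toVectorBundle), E.stab W L = (E.degree : ℝ) - 2 * (L.degree : ℝ) +
        ∑ i, ∑ k ∈ Finset.Icc 1 (D.n i), W.w i k * (1 - 2 * (E.jumpInt L i k : ℝ)) := by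
    intro E W L
    simp only [stab, jumpInt, Int.cast_natCast]
  have hne : ∑ i ∈ Finset.univ.erase i₀, ∑ k ∈ Finset.Icc 1 (D.n i),
        (W.elm i₀).w i k * (1 - 2 * ((E.elm i₀).jumpInt (E.elmSub i₀ L) i k : ℝ)) =
      ∑ i ∈ Finset.univ.erase i₀, ∑ k ∈ Finset.Icc 1 (D.n i),
        W.w i k * (1 - 2 * (E.jumpInt L i k : ℝ)) := by
    refine Finset.sum_congr rfl fun i hi => Finset.sum_congr rfl fun k hk => ?_
    have hi' : i ≠ i₀ := Finset.ne_of_mem_erase hi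
    rw [E.jumpInt_elm_of_ne L hi' (Finset.mem_Icc.mp hk).2]
    simp only [Weights.elm, if_neg hi']
  -- After the reflection k ↦ n - k + 1 each term is (1 - w)(2a - 1) = w(1 - 2a) + 2a - 1. The
  -- excess 2∑a - n cancels against the degrees.
  have heq : ∑ k ∈ Finset.Icc 1 (D.n i₀),
        (W.elm i₀).w i₀ k * (1 - 2 * ((E.elm i₀).jumpInt (E.elmSub i₀ L) i₀ k : ℝ)) =
      ∑ k ∈ Finset.Icc 1 (D.n i₀), W.w i₀ k * (1 - 2 * (E.jumpInt L i₀ k : ℝ)) +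
        2 * ∑ k ∈ Finset.Icc 1 (D.n i₀), (E.jumpInt L i₀ k : ℝ) - D.n i₀ := by
    calc _ = ∑ k ∈ Finset.Icc 1 (D.n i₀), (fun k => (1 - W.w i₀ k) *
          (2 * (E.jumpInt L i₀ k : ℝ) - 1)) (D.n i₀ - k + 1) := by
          refine Finset.sum_congr rfl fun k hk => ?_
          rw [E.jumpInt_elm L i₀ (Finset.mem_Icc.mp hk).1 (Finset.mem_Icc.mp hk).2]
          simp only [Weights.elm, if_true]
          push_cast
          ring
      _ = ∑ k ∈ Finset.Icc 1 (D.n i₀), (W.w i₀ k * (1 - 2 * (E.jumpInt L i₀ k : ℝ)) +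
          2 * (E.jumpInt L i₀ k : ℝ) - 1) := by
          refine (sum_Icc_reflect (fun k => (1 - W.w i₀ k) *
            (2 * (E.jumpInt L i₀ k : ℝ) - 1)) _).trans ?_
          exact Finset.sum_congr rfl fun k _ => by ring
      _ = _ := by
          rw [Finset.sum_sub_distrib, Finset.sum_add_distrib, ← Finset.mul_sum]
          simp
  rw [hstab, hstab, degree_elm, degree_elmSub, ← Finset.add_sum_erase _ _ (Finset.mem_univ i₀),
    ← Finset.add_sum_erase _ _ (Finset.mem_univ i₀), hne, heq]
  push_cast
  ring

/-! ### Tameness. -/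

/-- Allowing the empty partial sum j = 0 replaces N by max(N, 0). The range 0 ≤ j ≤ n is then stable
under j ↦ n - j, unlike 1 ≤ j ≤ n. -/
theorem max_N_zero (L : LineSubbundle E.toVectorBundle) (i : Fin D.ν) :
    (∀ j ≤ D.n i, ∑ k ∈ Finset.Icc 1 j, E.eps L i k ≤ max (E.N L i) 0) ∧
      ∃ j ≤ D.n i, max (E.N L i) 0 = ∑ k ∈ Finset.Icc 1 j, E.eps L i k := by
  constructor
  · intro j hj
    rcases Nat.eq_zero_or_pos j with rfl | hj0
    · exact le_max_right _ _
    · exact le_max_of_le_left (Finset.le_sup' (fun k' => ∑ k ∈ Finset.Icc 1 k', E.eps L i k)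
        (Finset.mem_Icc.mpr ⟨hj0, hj⟩))
  · rcases le_total (E.N L i) 0 with h | h
    · exact ⟨0, Nat.zero_le _, max_eq_right h⟩
    · obtain ⟨j, hj, hj'⟩ := Finset.exists_mem_eq_sup' (Finset.nonempty_Icc.mpr (D.n_pos i))
        (fun k' => ∑ k ∈ Finset.Icc 1 k', E.eps L i k)
      exact ⟨j, (Finset.mem_Icc.mp hj).2, (max_eq_left h).trans hj'⟩

/-- If deg E > 2 deg L, the left side is at most 0 and the inequality is automatic. If deg E ≤ 2 deg
L, it is positive, which forces the index set to be non-empty. -/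
theorem tame_iff : E.Tame ↔ ∀ L : LineSubbundle E.toVectorBundle,
    -E.degree + 2 * L.degree + 1 ≤ ∑ i, max (E.N L i) 0 := by
  have hsum : ∀ L : LineSubbundle E.toVectorBundle,
      ∑ i ∈ E.plusSet L, E.N L i = ∑ i, max (E.N L i) 0 := by
    intro L
    rw [plusSet, Finset.sum_filter]
    refine Finset.sum_congr rfl fun i _ => ?_
    split_ifs with h
    · exact (max_eq_left h.le).symm
    · exact (max_eq_right (not_lt.mp h)).symm
  constructor
  · intro h L
    rw [← hsum]
    by_cases hd : E.degree ≤ 2 * L.degree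
    · exact (h L hd).2
    · rw [hsum]
      have : 0 ≤ ∑ i, max (E.N L i) 0 := Finset.sum_nonneg fun i _ => le_max_right _ _
      omega
  · intro h L hd
    have hL := h L
    rw [← hsum] at hL
    refine ⟨?_, hL⟩
    by_contra hne
    rw [Finset.not_nonempty_iff_eq_empty.mp hne, Finset.sum_empty] at hL
    omega

/-- Since ε'_k = -ε_{n-k+1}, the first j new signs are the negatives of the last j old ones. -/
theorem sum_eps_elm (L : LineSubbundle E.toVectorBundle) (i : Fin D.ν) {j : ℕ}
    (hj : j ≤ D.n i) :
    ∑ k ∈ Finset.Icc 1 j, (E.elm i).eps (E.elmSub i L) i k =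
      ∑ k ∈ Finset.Icc 1 (D.n i - j), E.eps L i k - ∑ k ∈ Finset.Icc 1 (D.n i), E.eps L i k := by
  induction j with
  | zero => simp
  | succ j ih =>
    rw [Finset.sum_Icc_succ_top (by omega), ih (by omega),
      (E.elm i).eps_eq _ i (by omega) hj, E.jumpInt_elm L i (by omega) hj,
      show D.n i - j = D.n i - (j + 1) + 1 by omega, Finset.sum_Icc_succ_top (by omega),
      E.eps_eq L i (by omega : 1 ≤ D.n i - (j + 1) + 1) (by omega)]
    ring

theorem max_N_elm (L : LineSubbundle E.toVectorBundle) (i : Fin D.ν) :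
    max ((E.elm i).N (E.elmSub i L) i) 0 =
      max (E.N L i) 0 - ∑ k ∈ Finset.Icc 1 (D.n i), E.eps L i k := by
  obtain ⟨h1, j, hj, h2⟩ := E.max_N_zero L i
  obtain ⟨h1', j', hj', h2'⟩ := (E.elm i).max_N_zero (E.elmSub i L) i
  apply le_antisymm
  · rw [h2', E.sum_eps_elm L i hj']
    linarith [h1 (D.n i - j') (by omega)]
  · have h := h1' (D.n i - j) (by omega)
    rw [E.sum_eps_elm L i (by omega), show D.n i - (D.n i - j) = j by omega] at h
    linarith

theorem N_elm_of_ne (L : LineSubbundle E.toVectorBundle) {i₀ i : Fin D.ν} (hi : i ≠ i₀) :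
    (E.elm i₀).N (E.elmSub i₀ L) i = E.N L i := by
  refine Finset.sup'_congr _ rfl fun j hj => Finset.sum_congr rfl fun k hk => ?_
  have hk' : k ≤ D.n i := (Finset.mem_Icc.mp hk).2.trans (Finset.mem_Icc.mp hj).2
  rw [(E.elm i₀).eps_eq _ i (Finset.mem_Icc.mp hk).1 hk',
    E.eps_eq L i (Finset.mem_Icc.mp hk).1 hk', E.jumpInt_elm_of_ne L hi hk']

/-- Both bundles have generic fibre V, so the generic line of L' also defines a line subbundle of E.
Tameness of E thus controls every L'. -/
theorem exists_eq_elmSub (i₀ : Fin D.ν) (L' : LineSubbundle (E.elm i₀).toVectorBundle) :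
    ∃ L : LineSubbundle E.toVectorBundle, L' = E.elmSub i₀ L :=
  ⟨.ofGeneric _ L'.generic L'.finrank_generic, LineSubbundle.eq_of_generic_eq rfl⟩

/-- Tameness is preserved by elementary transformations. -/
theorem Tame.elm {E : RefinedParabolicBundle V D} (h : E.Tame) (i₀ : Fin D.ν) :
    (E.elm i₀).Tame := by
  rw [tame_iff] at h ⊢
  intro L'
  obtain ⟨L, rfl⟩ := E.exists_eq_elmSub i₀ L'
  have hL := h L
  -- This number is subtracted from both sides of the tameness inequality: on the left through the
  -- degrees, on the right by `max_N_elm`.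
  have heps : ∑ k ∈ Finset.Icc 1 (D.n i₀), E.eps L i₀ k =
      D.n i₀ - 2 * ∑ k ∈ Finset.Icc 1 (D.n i₀), E.jumpInt L i₀ k := by
    rw [Finset.sum_congr rfl fun k hk =>
      E.eps_eq L i₀ (Finset.mem_Icc.mp hk).1 (Finset.mem_Icc.mp hk).2,
      Finset.sum_sub_distrib, ← Finset.mul_sum]
    simp
  rw [← Finset.add_sum_erase _ _ (Finset.mem_univ i₀)] at hL ⊢
  have hne : ∑ i ∈ Finset.univ.erase i₀, max ((E.elm i₀).N (E.elmSub i₀ L) i) 0 =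
      ∑ i ∈ Finset.univ.erase i₀, max (E.N L i) 0 :=
    Finset.sum_congr rfl fun i hi => by rw [E.N_elm_of_ne L (Finset.ne_of_mem_erase hi)]
  rw [max_N_elm, heps, degree_elm, degree_elmSub, hne]
  linarith

/-! ### Decompositions. -/

/-- The lattice `A` is the sum of its intersections with `G₁` and `G₂`. -/
def Splits {p : Point} (G₁ G₂ : Submodule FunField V) (A : Submodule (localRing p) V) : Prop :=
  A ⊓ G₁.restrictScalars (localRing p) ⊔ A ⊓ G₂.restrictScalars (localRing p) = A

/-- Multiplication by 𝔪^j commutes with sums and with intersection with a line, and is injective on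
submodules. -/
theorem splits_pow_smul {p : Point} {G₁ G₂ : Submodule FunField V}
    {A : Submodule (localRing p) V} (j : ℕ) :
    Splits G₁ G₂ (IsLocalRing.maximalIdeal (localRing p) ^ j • A) ↔ Splits G₁ G₂ A := by
  unfold Splits
  rw [pow_smul_inf_restrictScalars, pow_smul_inf_restrictScalars, ← Submodule.smul_sup]
  exact (pow_smul_injective FunField j).eq_iff

/-- Decomposability in terms of the generic fibre. -/
theorem decomposable_iff : E.Decomposable ↔ ∃ G₁ G₂ : Submodule FunField V,
    Module.finrank FunField G₁ = 1 ∧ Module.finrank FunField G₂ = 1 ∧ Disjoint G₁ G₂ ∧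
    (∀ p, Splits G₁ G₂ (E.stalk p)) ∧
    ∀ i k, 1 ≤ k → k ≤ D.n i → Splits G₁ G₂ (E.filtration i k) := by
  constructor
  · rintro ⟨L₁, L₂, h1, h2⟩
    refine ⟨L₁.generic, L₂.generic, L₁.finrank_generic, L₂.finrank_generic, ?_, fun p => ?_,
      fun i k hk1 hk => ?_⟩
    · rw [Submodule.disjoint_def]
      intro v hv1 hv2
      -- Any point would do: a common generic vector is scaled into a stalk, where the two line
      -- subbundles are disjoint.
      obtain ⟨a, ha, hav⟩ := exists_smul_mem (E.stalk .infty) (v := v)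
        (by rw [E.span_stalk]; exact Submodule.mem_top)
      have h0 : (a : FunField) ≠ 0 := fun h => ha (Subtype.ext h)
      have h3 := Submodule.disjoint_def.mp (h1 .infty).1 (a • v)
        ((L₁.mem_stalk _ _).mpr ⟨hav, L₁.generic.smul_mem (a : FunField) hv1⟩)
        ((L₂.mem_stalk _ _).mpr ⟨hav, L₂.generic.smul_mem (a : FunField) hv2⟩)
      exact (smul_eq_zero_iff_right h0).mp h3
    · unfold Splits
      rw [← L₁.stalk_eq, ← L₂.stalk_eq]
      exact (h1 p).2
    · have h3 := (h2 i k hk1 hk).2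
      rw [l_inf_fiber, l_inf_fiber, ← toQuot_sup (inf_le_left.trans (E.filtration_le i k))
        (inf_le_left.trans (E.filtration_le i k))] at h3
      -- The sum of the two intersections contains the twist because the twist itself splits; the
      -- equality in the fibre therefore lifts to V.
      have htw : E.twist (D.t i) (D.n i) ≤
          E.filtration i k ⊓ L₁.generic.restrictScalars (localRing (D.t i)) ⊔
            E.filtration i k ⊓ L₂.generic.restrictScalars (localRing (D.t i)) := by
        have hs : Splits L₁.generic L₂.generic (E.twist (D.t i) (D.n i)) := by
          rw [VectorBundle.twist, splits_pow_smul, Splits, ← L₁.stalk_eq, ← L₂.stalk_eq]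
          exact (h1 _).2
        rw [← hs]
        exact sup_le_sup (inf_le_inf_right _ (E.twist_le_filtration i k))
          (inf_le_inf_right _ (E.twist_le_filtration i k))
      have h4 := congrArg ofQuot h3
      rw [ofQuot_toQuot htw ((sup_le inf_le_left inf_le_left).trans (E.filtration_le i k))] at h4
      exact h4.symm
  · rintro ⟨G₁, G₂, hG₁, hG₂, hd, h1, h2⟩
    refine ⟨.ofGeneric _ G₁ hG₁, .ofGeneric _ G₂ hG₂, fun p => ⟨?_, h1 p⟩, fun i k hk1 hk => ?_⟩
    · rw [Submodule.disjoint_def]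
      exact fun v hv1 hv2 => Submodule.disjoint_def.mp hd v hv1.2 hv2.2
    · rw [l_inf_fiber, l_inf_fiber]
      constructor
      · rw [Submodule.disjoint_def]
        rintro _ ⟨x, hx, rfl⟩ ⟨y, hy, hxy⟩
        -- The difference y - x splits as c₁ + c₂ within the twist, so x + c₁ = y - c₂ lies in both
        -- lines and vanishes; hence x is in the twist.
        have hC : ((y - x : E.stalk (D.t i)) : V) ∈ E.twist (D.t i) (D.n i) :=
          (Submodule.Quotient.eq ((E.twist (D.t i) (D.n i)).submoduleOf _)).mp hxy
        have hs : Splits G₁ G₂ (E.twist (D.t i) (D.n i)) := by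
          rw [VectorBundle.twist, splits_pow_smul]; exact h1 _
        rw [← hs] at hC
        obtain ⟨c₁, hc₁, c₂, hc₂, hc⟩ := Submodule.mem_sup.mp hC
        have hc' : c₁ + c₂ = (y : V) - x := hc
        have hx' : (x : V) + c₁ ∈ G₁ := G₁.add_mem hx.2 hc₁.2
        have hy' : (x : V) + c₁ ∈ G₂ := by
          have : (x : V) + c₁ = y - c₂ := by rw [eq_sub_iff_add_eq, add_assoc, hc']; abel
          rw [this]; exact G₂.sub_mem hy.2 hc₂.2
        have h0 := Submodule.disjoint_def.mp hd _ hx' hy'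
        refine (Submodule.Quotient.mk_eq_zero ((E.twist (D.t i) (D.n i)).submoduleOf _)).mpr ?_
        show (x : V) ∈ E.twist (D.t i) (D.n i)
        rw [eq_neg_of_add_eq_zero_left h0]
        exact Submodule.neg_mem _ hc₁.1
      · rw [← toQuot_sup (inf_le_left.trans (E.filtration_le i k))
          (inf_le_left.trans (E.filtration_le i k))]
        refine (toQuot_ofQuot (E.l i k)).symm.trans ?_
        exact congrArg _ (h2 i k hk1 hk).symm

theorem Decomposable.of_elm {E : RefinedParabolicBundle V D} {i₀ : Fin D.ν}
    (h : (E.elm i₀).Decomposable) : E.Decomposable := by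
  rw [decomposable_iff] at h ⊢
  obtain ⟨G₁, G₂, hG₁, hG₂, hd, h1, h2⟩ := h
  have h1' : ∀ p, Splits G₁ G₂ ((E.elmBundle i₀).stalk p) := h1
  have hfil : ∀ k, k ≤ D.n i₀ → Splits G₁ G₂ (E.filtration i₀ k) := by
    intro k hk
    -- The step k = n is the stalk of E' itself. For k < n, the index n - k lies in 1, …, n, where
    -- the decomposition of the transform gives information.
    rcases eq_or_lt_of_le hk with rfl | hk'
    · rw [← E.elmBundle_stalk_self]; exact h1' _
    · have h3 := h2 i₀ (D.n i₀ - k) (by omega) (by omega)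
      rwa [elm_filtration _ _ _ (by omega : D.n i₀ - k ≤ D.n i₀), elmFiltration_self,
        show D.n i₀ - (D.n i₀ - k) = k by omega, splits_pow_smul] at h3
  refine ⟨G₁, G₂, hG₁, hG₂, hd, fun p => ?_, fun i k hk1 hk => ?_⟩
  · by_cases hp : p = D.t i₀
    · subst hp
      -- The step k = 0 is 𝔪^n E, from which the splitting of the original stalk is recovered.
      have h3 := hfil 0 (Nat.zero_le _)
      rwa [filtration_zero, VectorBundle.twist, splits_pow_smul] at h3
    · rw [← E.elmBundle_stalk_of_ne i₀ hp]; exact h1' p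
  · by_cases hi : i = i₀
    · subst hi; exact hfil k hk
    · have h3 := h2 i k hk1 hk
      rwa [elm_filtration _ _ _ hk, E.elmFiltration_of_ne hi] at h3

end RefinedParabolicBundle

end RefinedParabolic

end

theorem mainTheorem7 {V : Type*} [AddCommGroup V] [Module RefinedParabolic.FunField V]
    {D : RefinedParabolic.PolarDivisor} (E : RefinedParabolic.RefinedParabolicBundle V D)
    (i₀ : Fin D.ν) :
    (∀ (W : RefinedParabolic.Weights D) (L : RefinedParabolic.LineSubbundle E.toVectorBundle),
      E.stab W L = (E.elm i₀).stab (W.elm i₀) (E.elmSub i₀ L)) ∧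
    (E.Tame → (E.elm i₀).Tame) ∧
    (E.Undecomposable → (E.elm i₀).Undecomposable) :=
  ⟨E.stab_elm i₀, fun h => h.elm i₀, fun h h' => h h'.of_elm⟩
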